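/- Let $(X,\mathcal B,m)$ be a $\sigma$-finite measure space and let $T:X\to X$ be a conservative, ergodic, measure preserving transformation. For $A\in\mathcal B$ and $x\in A$ let $\varphi_A(x):=\min\{n\ge 1: T^nx\in A\}$ (with $\min\emptyset=\infty$). $T$ is called *log-lower bounded* (LLB) if there is a set $A\in\mathcal B$ with $0<m(A)<\infty$ and $\int_A\log\varphi_A\,dm<\infty$. The transfer operator $\widehat T:L^1(m)\to L^1(m)$ is defined by $\int_A\widehat Tf\,dm=\int_{T^{-1}A}f\,dm$ for $f\in L^1(m)$, $A\in\mathcal B$. $T$ is called *pointwise dual ergodic* if there is a sequence of positive constants $(a_n(T))_{n\ge1}$, called a *return sequence* of $T$, such that $$\frac1{a_n(T)}\sum_{k=0}^{n-1}\widehat T^kf\longrightarrow\int_Xf\,dm\quad\text{a.e. as } n\to\infty$$ for some $f\in L^1(m)$ with $f\ge0$ and $\int_Xf\,dm>0$. **Proposition 3.1.** Let $T$ be a pointwise dual ergodic, conservative, ergodic, measure preserving transformation of a $\sigma$-finite measure space, and let $(a_n(T))_{n\ge1}$ be any return sequence of $T$. Then $$T\text{ is LLB}\iff\sum_{n=1}^\infty\frac1{n\,a_n(T)}<\infty.$$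 Moreover, for $d\in\{1,2\}$ consider simple random walk on $\mathbb Z^d$ as the shift $(w_n)_{n\ge0}\mapsto(w_{n+1})_{n\ge0}$ on the path space $(\mathbb Z^d)^{\{0,1,2,\dots\}}$ with the $\sigma$-finite measure $\sum_{x\in\mathbb Z^d}P_x$, where $P_x$ is the law of the walk started at $x$ with independent steps uniformly distributed on the $2d$ unit vectors $\pm e_i$. For both $d=1$ and $d=2$ this is a pointwise dual ergodic, conservative, ergodic, measure preserving transformation; it is LLB for $d=1$, and it is not LLB for $d=2$. -/

import Mathlib

open MeasureTheory Filter Topology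
open scoped ENNReal

noncomputable section

namespace LogLowerBounded

/-- The first return time `φ_A(x) = min {n ≥ 1 : Tⁿ x ∈ A}`, equal to `∞` if there is no such `n`. -/
def returnTime {X : Type*} (T : X → X) (A : Set X) (x : X) : ℝ≥0∞ :=
  ⨅ (n : ℕ) (_ : 1 ≤ n ∧ T^[n] x ∈ A), (n : ℝ≥0∞)

/-- The class of measurable sets `A` with `0 < m(A) < ∞` and `∫_A log φ_A dm < ∞`. The integrand is
nonnegative since `φ_A ≥ 1`; it is `∞` where `φ_A = ∞`. -/
def logIntegrableSets {X : Type*} [MeasurableSpace X] (T : X → X) (m : Measure X) : Set (Set X) :=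
  {A | MeasurableSet A ∧ 0 < m A ∧ m A < ∞ ∧
    ∫⁻ x in A, (ENNReal.log (returnTime T A x)).toENNReal ∂m < ∞}

/-- `T` is log-lower bounded (LLB). -/
def IsLLB {X : Type*} [MeasurableSpace X] (T : X → X) (m : Measure X) : Prop :=
  (logIntegrableSets T m).Nonempty

/-- The transfer operator `T̂` on integrable functions: `T̂ f` is the density with respect to `m` of
the signed measure `A ↦ ∫_{T⁻¹A} f dm`, see `setIntegral_transfer`. -/
def transfer {X : Type*} [MeasurableSpace X] (T : X → X) (m : Measure X) (f : X → ℝ) : X → ℝ :=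
  SignedMeasure.rnDeriv ((m.withDensityᵥ f).map T) m

theorem integrable_transfer {X : Type*} [MeasurableSpace X] (T : X → X) (m : Measure X)
    (f : X → ℝ) : Integrable (transfer T m f) m :=
  SignedMeasure.integrable_rnDeriv _ _

/-- The defining property of the transfer operator. -/
theorem setIntegral_transfer {X : Type*} [MeasurableSpace X] {T : X → X} {m : Measure X}
    [SigmaFinite m] (hT : MeasurePreserving T m m) {f : X → ℝ} (hf : Integrable f m)
    {A : Set X} (hA : MeasurableSet A) :
    ∫ x in A, transfer T m f x ∂m = ∫ x in T ⁻¹' A, f x ∂m := by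
  have hac : VectorMeasure.AbsolutelyContinuous ((m.withDensityᵥ f).map T)
      m.toENNRealVectorMeasure := by
    refine VectorMeasure.AbsolutelyContinuous.mk fun s hs h0 => ?_
    rw [Measure.toENNRealVectorMeasure_apply_measurable hs] at h0
    rw [VectorMeasure.map_apply _ hT.measurable hs,
      withDensityᵥ_apply hf (hT.measurable hs)]
    exact setIntegral_measure_zero _ (by rw [hT.measure_preimage hs.nullMeasurableSet, h0])
  have h := (SignedMeasure.absolutelyContinuous_iff_withDensityᵥ_rnDeriv_eq
    ((m.withDensityᵥ f).map T) m).1 hac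
  have h2 := congrArg (fun v => v A) h
  rw [withDensityᵥ_apply (SignedMeasure.integrable_rnDeriv _ _) hA,
    VectorMeasure.map_apply _ hT.measurable hA, withDensityᵥ_apply hf (hT.measurable hA)] at h2
  exact h2

/-- The positive constants `a n` (`n ≥ 1`) form a return sequence of `T`: for some nonnegative
integrable `f` with `∫ f dm > 0`, the averages `(1 / a n) ∑_{k < n} T̂ᵏ f` converge to `∫ f dm`
almost everywhere. -/
def IsReturnSequence {X : Type*} [MeasurableSpace X] (T : X → X) (m : Measure X) (a : ℕ → ℝ) :
    Prop :=
  (∀ n, 1 ≤ n → 0 < a n) ∧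
  ∃ f : X → ℝ, Integrable f m ∧ 0 ≤ᵐ[m] f ∧ 0 < ∫ x, f x ∂m ∧
    ∀ᵐ x ∂m, Tendsto (fun n : ℕ => 1 / a n * ∑ k ∈ Finset.range n, ((transfer T m)^[k] f) x)
      atTop (𝓝 (∫ x, f x ∂m))

/-- Pointwise dual ergodicity of `T` (meant for conservative, ergodic, measure preserving `T`). -/
def IsPointwiseDualErgodic {X : Type*} [MeasurableSpace X] (T : X → X) (m : Measure X) : Prop :=
  ∃ a : ℕ → ℝ, IsReturnSequence T m a

/-- The path `x, x + ξ₀, x + ξ₀ + ξ₁, …` of a walk. -/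
def walkPath {G : Type*} [AddCommGroup G] (x : G) (ξ : ℕ → G) : ℕ → G :=
  fun n => x + ∑ i ∈ Finset.range n, ξ i

/-- The law on path space of the random walk started at `x` with independent steps of law `p`. -/
def walkLaw {G : Type*} [AddCommGroup G] [MeasurableSpace G] (p : PMF G) (x : G) :
    Measure (ℕ → G) :=
  (Measure.infinitePi fun _ : ℕ => p.toMeasure).map (walkPath x)

/-- The stationary measure on path space: the walk is started from the counting measure on `G`. -/
def walkMeasure {G : Type*} [AddCommGroup G] [MeasurableSpace G] (p : PMF G) : Measure (ℕ → G) :=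
  Measure.sum fun x : G => walkLaw p x

/-- The shift on path space. -/
def shift {G : Type*} (w : ℕ → G) : ℕ → G := fun n => w (n + 1)

/-- The step law of simple random walk on `ℤ`. -/
def stepZ : PMF ℤ := PMF.uniformOfFinset {1, -1} ⟨1, by simp⟩

/-- The step law of simple random walk on `ℤ²`. -/
def stepZ2 : PMF (ℤ × ℤ) :=
  PMF.uniformOfFinset {(1, 0), (-1, 0), (0, 1), (0, -1)} ⟨(1, 0), by simp⟩

end LogLowerBounded

end

/-!
# Log-lower bounded maps and return sequences

Let `R n = A ∩ {φ_A > n}`. Since harmonic numbers and logarithms differ by at most one, the function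
`log φ_A` is integrable over `A` if and only if `∑ m(R n) / (n + 1)` converges
(`lintegral_log_returnTime_lt_top_iff`). The tails `m(R n)` are compared with the return sequence
by decomposing orbits at their last visit to `A`. With `ν = f dm` and `S n = ∑_{k < n} T̂ᵏ f`, summing
the decomposition over the times below `N` gives the renewal identity (`sum_measure_hitBy`)

  `∑_{n < N} ν(A is visited during [0, n]) = ∑_{l < N} ∫_{R l} S (N - l) dm`.

Its left side is at most `N ν(X)`, and at least a constant times `N` because almost every orbit
visits `A`. Pointwise dual ergodicity makes `S n` comparable with `a n`, uniformly on a subset of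
positive measure of any given set (`exists_uniform_subset`).

* If `S n ≥ c a n` on `A`, the identity gives `m(R n) = O(1 / a n)`, so convergence of
  `∑ 1 / (n a n)` makes `A` a set with integrable `log φ_A`.
* If `S n ≤ C a n` on `A`, it gives `n / a n = O(∑_{l < n} m(R l))`. Dividing by `n²` and summing
  over `n` bounds `∑ 1 / (n a n)` by a multiple of `∑ m(R l) / (l + 1)`. Here one has to pass from
  the given set to a subset, which is possible by the easy half of Kac's formula and the
  subadditivity of harmonic numbers (`returnSeries_le_of_subset`).

Only the given `f` enters, so that no ratio ergodic theorem is needed.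

For a random walk on a countable abelian group whose possible steps generate the group as a monoid,
let `p_k` be the `k`-step transition probabilities from `0`. If `∑ p_k(0) = ∞`, then wandering sets
are null (`conservative_shift`). Bounded harmonic functions are constant (`harmonic_const`), so an
invariant event has the same probability from every starting point, is therefore independent of the
events depending on finitely many coordinates, hence of itself (`ergodic_shift`). The function
`p_k(w 0)` is the image under `T̂ᵏ` of the indicator of `{w 0 = 0}`; by a maximum principle the
truncated Green functions `∑_{k < n} p_k(y)` and `∑_{k < n} p_k(0)` differ by a bounded amount for
each `y`, so the latter is a return sequence (`isReturnSequence_green`).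

For simple random walk on `ℤ`, `p_{2k}(0) = C(2k, k) / 4ᵏ` is of order `1 / √k`, so the return
sequence is at least of order `√n` and `∑ 1 / (n √n)` converges. On `ℤ²` the walk is, in the
coordinates `x ± y`, a pair of independent walks on `ℤ`; hence `p_k(0) ≤ 1 / (k + 1)`, the return
sequence is at most of order `log n`, and `∑ 1 / (n log n)` diverges.
-/

namespace LogLowerBounded

/-! ### Return times and last visits -/

theorem tsum_sum_antidiagonal (g : ℕ → ℕ → ℝ≥0∞) :
    ∑' n, ∑ p ∈ Finset.HasAntidiagonal.antidiagonal n, g p.1 p.2 = ∑' i, ∑' j, g i j := by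
  rw [← ENNReal.tsum_prod, ← (Finset.HasAntidiagonal.sigmaAntidiagonalEquivProd (A := ℕ)).tsum_eq,
    ENNReal.tsum_sigma']
  refine tsum_congr fun n => ?_
  rw [← Finset.tsum_subtype]
  rfl

section NoReturn

variable {X : Type*}

/-- The set `A ∩ {φ_A > n}` of points of `A` that do not return to `A` at the times `1, …, n`. -/
def noReturn (T : X → X) (A : Set X) (n : ℕ) : Set X :=
  {x | x ∈ A ∧ ∀ i, 1 ≤ i → i ≤ n → T^[i] x ∉ A}

theorem noReturn_subset (T : X → X) (A : Set X) (n : ℕ) : noReturn T A n ⊆ A := fun _ hx => hx.1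

theorem noReturn_anti (T : X → X) (A : Set X) : Antitone (noReturn T A) :=
  fun _ _ hij _ hx => ⟨hx.1, fun k hk hk' => hx.2 k hk (hk'.trans hij)⟩

theorem measurableSet_noReturn [MeasurableSpace X] {T : X → X} (hT : Measurable T) {A : Set X}
    (hA : MeasurableSet A) (n : ℕ) : MeasurableSet (noReturn T A n) := by
  have : noReturn T A n = A ∩ ⋂ i, ⋂ (_ : 1 ≤ i), ⋂ (_ : i ≤ n), (T^[i] ⁻¹' A)ᶜ := by
    ext x; simp [noReturn]
  rw [this]
  exact hA.inter (.iInter fun i => .iInter fun _ => .iInter fun _ => (hT.iterate i hA).compl)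

/-- The sets of points whose last visit to `A` during `[0, n]` takes place at time `j` are
pairwise disjoint. -/
theorem pairwiseDisjoint_lastVisit (T : X → X) (A : Set X) (n : ℕ) :
    Set.PairwiseDisjoint (↑(Finset.range (n + 1)) : Set ℕ)
      fun j => T^[j] ⁻¹' noReturn T A (n - j) := by
  have key : ∀ i j : ℕ, i < j → j ≤ n →
      Disjoint (T^[i] ⁻¹' noReturn T A (n - i)) (T^[j] ⁻¹' noReturn T A (n - j)) := by
    intro i j hij hj
    refine Set.disjoint_left.2 fun x hx hy => hx.2 (j - i) (by omega) (by omega) ?_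
    rw [← Function.iterate_add_apply, Nat.sub_add_cancel hij.le]
    exact hy.1
  intro i hi j hj hij
  simp only [Finset.coe_range, Set.mem_Iio] at hi hj
  rcases lt_or_gt_of_ne hij with h | h
  · exact key i j h (by omega)
  · exact (key j i h (by omega)).symm

/-- The set of points that visit `A` at one of the times `0, …, n`. -/
def hitBy (T : X → X) (A : Set X) (n : ℕ) : Set X := {x | ∃ j ≤ n, T^[j] x ∈ A}

theorem hitBy_mono (T : X → X) (A : Set X) : Monotone (hitBy T A) :=
  fun _ _ hij _ ⟨k, hk, hx⟩ => ⟨k, hk.trans hij, hx⟩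

theorem exists_last_visit {T : X → X} {A : Set X} {n : ℕ} {x : X} (hx : x ∈ hitBy T A n) :
    ∃ j ≤ n, T^[j] x ∈ noReturn T A (n - j) := by
  classical
  obtain ⟨j₀, hj₀, hA⟩ := hx
  refine ⟨Nat.findGreatest (fun j => T^[j] x ∈ A) n, Nat.findGreatest_le n,
    Nat.findGreatest_spec (P := fun j => T^[j] x ∈ A) hj₀ hA, fun i hi hi' => ?_⟩
  rw [← Function.iterate_add_apply]
  have hle : Nat.findGreatest (fun j => T^[j] x ∈ A) n ≤ n := Nat.findGreatest_le n
  exact Nat.findGreatest_is_greatest (P := fun j => T^[j] x ∈ A) (n := n) (by omega) (by omega)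

theorem hitBy_eq_biUnion (T : X → X) (A : Set X) (n : ℕ) :
    hitBy T A n = ⋃ j ∈ Finset.range (n + 1), T^[j] ⁻¹' noReturn T A (n - j) := by
  ext x
  simp only [Set.mem_iUnion, Finset.mem_range, exists_prop, Set.mem_preimage]
  constructor
  · intro hx
    obtain ⟨j, hj, h⟩ := exists_last_visit hx
    exact ⟨j, by omega, h⟩
  · rintro ⟨j, hj, h⟩
    exact ⟨j, by omega, h.1⟩

theorem tsum_ennreal_inv_add_one : ∑' n : ℕ, ((n : ℝ≥0∞) + 1)⁻¹ = ∞ := by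
  by_contra h
  have h1 : Summable fun n : ℕ => ((((n : ℝ≥0∞) + 1)⁻¹).toReal) := ENNReal.summable_toReal h
  refine Real.not_summable_one_div_natCast ((summable_nat_add_iff 1).1 (h1.congr fun n => ?_))
  rw [ENNReal.toReal_inv, ENNReal.toReal_add (by simp) (by simp)]
  simp

theorem sum_range_inv_add_one (k : ℕ) :
    ∑ n ∈ Finset.range k, ((n : ℝ≥0∞) + 1)⁻¹ = ENNReal.ofReal (harmonic k : ℚ) := by
  rw [harmonic]
  push_cast
  rw [ENNReal.ofReal_sum_of_nonneg fun i _ => by positivity]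
  refine Finset.sum_congr rfl fun n _ => ?_
  rw [ENNReal.ofReal_inv_of_pos (by positivity), ENNReal.ofReal_add (by positivity) (by simp)]
  simp

/-- On `A`, the harmonic number of the return time `φ_A`, here written as a sum over the sets
`A ∩ {φ_A > n}`, differs from `log φ_A` by at most one. -/
theorem log_returnTime_le_and_le (T : X → X) (A : Set X) {x : X} (hx : x ∈ A) :
    (ENNReal.log (returnTime T A x)).toENNReal ≤
        ∑' n : ℕ, (noReturn T A n).indicator (fun _ => ((n : ℝ≥0∞) + 1)⁻¹) x ∧
      ∑' n : ℕ, (noReturn T A n).indicator (fun _ => ((n : ℝ≥0∞) + 1)⁻¹) x ≤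
        1 + (ENNReal.log (returnTime T A x)).toENNReal := by
  classical
  by_cases h : ∃ n, 1 ≤ n ∧ T^[n] x ∈ A
  · set k := Nat.find h with hk
    have hk1 : 1 ≤ k := (Nat.find_spec h).1
    have hkA : T^[k] x ∈ A := (Nat.find_spec h).2
    have hmin : ∀ i, 1 ≤ i → i < k → T^[i] x ∉ A := fun i hi hik hA =>
      Nat.find_min h hik ⟨hi, hA⟩
    have hφ : returnTime T A x = k := by
      refine le_antisymm (iInf₂_le k ⟨hk1, hkA⟩) (le_iInf₂ fun n hn => ?_)
      exact_mod_cast Nat.find_min' h hn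
    have hmem : ∀ n, x ∈ noReturn T A n ↔ n < k := by
      intro n
      constructor
      · intro hn
        by_contra hkn
        exact hn.2 k hk1 (not_lt.1 hkn) hkA
      · exact fun hn => ⟨hx, fun i hi hin => hmin i hi (by omega)⟩
    have hsum : ∑' n : ℕ, (noReturn T A n).indicator (fun _ => ((n : ℝ≥0∞) + 1)⁻¹) x =
        ENNReal.ofReal (harmonic k : ℚ) := by
      rw [← sum_range_inv_add_one, tsum_eq_sum (s := Finset.range k)]
      · refine Finset.sum_congr rfl fun n hn => ?_
        rw [Set.indicator_of_mem ((hmem n).2 (Finset.mem_range.1 hn))]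
      · intro n hn
        rw [Set.indicator_of_notMem]
        rw [hmem]; simpa using hn
    have hkpos : (0 : ℝ) < k := by exact_mod_cast hk1
    have hlog : (ENNReal.log (returnTime T A x)).toENNReal = ENNReal.ofReal (Real.log k) := by
      rw [hφ, ← ENNReal.ofReal_natCast, ENNReal.log_ofReal_of_pos hkpos]
      simp
    rw [hsum, hlog]
    refine ⟨ENNReal.ofReal_le_ofReal ?_, ?_⟩
    · refine le_trans (Real.log_le_log hkpos ?_) (log_add_one_le_harmonic k)
      push_cast; linarith
    · rw [← ENNReal.ofReal_one, ← ENNReal.ofReal_add zero_le_one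
        (Real.log_nonneg (by exact_mod_cast hk1))]
      exact ENNReal.ofReal_le_ofReal (harmonic_le_one_add_log k)
  · push Not at h
    have hφ : returnTime T A x = ∞ := by
      simp only [returnTime, iInf_eq_top]
      exact fun n hn => absurd hn.2 (h n hn.1)
    have hmem : ∀ n, x ∈ noReturn T A n := fun n => ⟨hx, fun i hi _ => h i hi⟩
    have hsum : ∑' n : ℕ, (noReturn T A n).indicator (fun _ => ((n : ℝ≥0∞) + 1)⁻¹) x = ∞ := by
      rw [← tsum_ennreal_inv_add_one]
      exact tsum_congr fun n => Set.indicator_of_mem (hmem n) _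
    rw [hsum, hφ]
    simp

variable [MeasurableSpace X] {T : X → X} {m : Measure X} {A B : Set X}

/-- Decomposition of a visit to `A` during `[0, n]` according to the time of the last visit. -/
theorem measure_hitBy (ν : Measure X) (hT : Measurable T) (hA : MeasurableSet A) (n : ℕ) :
    ν (hitBy T A n) = ∑ j ∈ Finset.range (n + 1), ν (T^[j] ⁻¹' noReturn T A (n - j)) := by
  rw [hitBy_eq_biUnion]
  exact measure_biUnion_finset (pairwiseDisjoint_lastVisit T A n)
    fun j _ => hT.iterate j (measurableSet_noReturn hT hA _)

/-- The easy half of Kac's formula: up to the first return, the visits of the orbits of points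
of `A` to a set `E` have total mass at most `m E`. -/
theorem tsum_measure_noReturn_inter_le (hT : MeasurePreserving T m m) (hA : MeasurableSet A)
    {E : Set X} (hE : MeasurableSet E) :
    ∑' j, m (noReturn T A j ∩ T^[j] ⁻¹' E) ≤ m E := by
  rw [ENNReal.tsum_eq_iSup_nat]
  refine iSup_le fun N => ?_
  rcases N with _ | n
  · simp
  have hmeas : ∀ j, MeasurableSet (noReturn T A j ∩ T^[j] ⁻¹' E) := fun j =>
    (measurableSet_noReturn hT.measurable hA j).inter ((hT.iterate j).measurable hE)
  calc ∑ j ∈ Finset.range (n + 1), m (noReturn T A j ∩ T^[j] ⁻¹' E)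
      = ∑ j ∈ Finset.range (n + 1), m (noReturn T A (n - j) ∩ T^[n - j] ⁻¹' E) := by
        rw [← Finset.sum_range_reflect]
        simp
    _ = ∑ j ∈ Finset.range (n + 1),
          m (T^[j] ⁻¹' (noReturn T A (n - j) ∩ T^[n - j] ⁻¹' E)) :=
        Finset.sum_congr rfl fun j _ =>
          ((hT.iterate j).measure_preimage (hmeas _).nullMeasurableSet).symm
    _ = m (⋃ j ∈ Finset.range (n + 1), T^[j] ⁻¹' (noReturn T A (n - j) ∩ T^[n - j] ⁻¹' E)) :=
        (measure_biUnion_finset ((pairwiseDisjoint_lastVisit T A n).mono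
          fun j => Set.preimage_mono Set.inter_subset_left)
          fun j _ => (hT.iterate j).measurable (hmeas _)).symm
    _ ≤ m (T^[n] ⁻¹' E) := by
        refine measure_mono (Set.iUnion₂_subset fun j hj x hx => ?_)
        have hx2 := hx.2
        simp only [Set.mem_preimage, ← Function.iterate_add_apply] at hx2
        rwa [Nat.sub_add_cancel (by simpa [Nat.lt_succ_iff] using hj)] at hx2
    _ = m E := (hT.iterate n).measure_preimage hE.nullMeasurableSet

/-- The series `∑ m(A ∩ {φ_A > n}) / (n + 1)`, whose finiteness expresses the integrability
of `log φ_A` over `A`. -/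
noncomputable def returnSeries (T : X → X) (m : Measure X) (A : Set X) : ℝ≥0∞ :=
  ∑' n : ℕ, m (noReturn T A n) * ((n : ℝ≥0∞) + 1)⁻¹

/-- Finiteness of the return series is inherited by subsets: between two visits to `B` the orbit
makes excursions from `A`, and the harmonic sum of the total length is at most the sum of the
harmonic sums of the excursions. -/
theorem returnSeries_le_of_subset (hT : MeasurePreserving T m m) (hA : MeasurableSet A)
    (hB : MeasurableSet B) (hBA : B ⊆ A) : returnSeries T m B ≤ returnSeries T m A := by
  have hsub : ∀ n, noReturn T B n ⊆
      ⋃ j ∈ Finset.range (n + 1), noReturn T B j ∩ T^[j] ⁻¹' noReturn T A (n - j) := by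
    intro n x hx
    obtain ⟨j, hj, h⟩ := exists_last_visit (T := T) (A := A) (n := n)
      ⟨0, Nat.zero_le _, hBA hx.1⟩
    simp only [Set.mem_iUnion, Finset.mem_range, exists_prop]
    exact ⟨j, by omega, noReturn_anti T B hj hx, h⟩
  calc returnSeries T m B
      ≤ ∑' n : ℕ, ∑ p ∈ Finset.HasAntidiagonal.antidiagonal n,
          m (noReturn T B p.1 ∩ T^[p.1] ⁻¹' noReturn T A p.2) * ((p.2 : ℝ≥0∞) + 1)⁻¹ := by
        refine ENNReal.tsum_le_tsum fun n => ?_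
        rw [Finset.Nat.sum_antidiagonal_eq_sum_range_succ (fun j l =>
          m (noReturn T B j ∩ T^[j] ⁻¹' noReturn T A l) * ((l : ℝ≥0∞) + 1)⁻¹)]
        calc m (noReturn T B n) * ((n : ℝ≥0∞) + 1)⁻¹
            ≤ (∑ j ∈ Finset.range (n + 1), m (noReturn T B j ∩ T^[j] ⁻¹' noReturn T A (n - j)))
                * ((n : ℝ≥0∞) + 1)⁻¹ := by
              gcongr
              exact (measure_mono (hsub n)).trans (measure_biUnion_finset_le _ _)
          _ ≤ _ := by
              rw [Finset.sum_mul]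
              gcongr with j hj
              exact Nat.sub_le _ _
    _ = ∑' l : ℕ, ∑' j : ℕ,
          m (noReturn T B j ∩ T^[j] ⁻¹' noReturn T A l) * ((l : ℝ≥0∞) + 1)⁻¹ := by
        rw [ENNReal.tsum_comm]
        exact tsum_sum_antidiagonal fun j l =>
          m (noReturn T B j ∩ T^[j] ⁻¹' noReturn T A l) * ((l : ℝ≥0∞) + 1)⁻¹
    _ ≤ returnSeries T m A := by
        refine ENNReal.tsum_le_tsum fun l => ?_
        rw [ENNReal.tsum_mul_right]
        gcongr
        exact tsum_measure_noReturn_inter_le hT hB (measurableSet_noReturn hT.measurable hA l)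

theorem lintegral_log_returnTime_lt_top_iff (hT : Measurable T) (hA : MeasurableSet A)
    (hfin : m A < ∞) :
    ∫⁻ x in A, (ENNReal.log (returnTime T A x)).toENNReal ∂m < ∞ ↔ returnSeries T m A < ∞ := by
  have hser : returnSeries T m A =
      ∫⁻ x in A, ∑' n : ℕ, (noReturn T A n).indicator (fun _ => ((n : ℝ≥0∞) + 1)⁻¹) x ∂m := by
    rw [lintegral_tsum fun n =>
      (measurable_const.indicator (measurableSet_noReturn hT hA n)).aemeasurable]
    refine tsum_congr fun n => ?_
    rw [lintegral_indicator (measurableSet_noReturn hT hA n), setLIntegral_const,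
      Measure.restrict_apply (measurableSet_noReturn hT hA n),
      Set.inter_eq_left.2 (noReturn_subset T A n), mul_comm]
  rw [hser]
  constructor
  · intro h
    refine lt_of_le_of_lt (setLIntegral_mono' hA fun x hx =>
      (log_returnTime_le_and_le T A hx).2) ?_
    rw [lintegral_add_left measurable_const]
    refine ENNReal.add_lt_top.2 ⟨?_, h⟩
    simpa using hfin
  · exact lt_of_le_of_lt (setLIntegral_mono' hA fun x hx => (log_returnTime_le_and_le T A hx).1)

end NoReturn

/-! ### The renewal identity and its two consequences -/

section Renewal

variable {X : Type*} [MeasurableSpace X] {T : X → X} {m ν : Measure X} {A B : Set X}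
  {F : ℕ → X → ℝ≥0∞}

/-- `F k` is a density with respect to `m` of the push-forward of `ν` under `Tᵏ`. When `ν` has
density `f`, this says that `F k` is a version of `T̂ᵏ f`, taken with values in `[0, ∞]`. -/
structure IsDualDensity (T : X → X) (m ν : Measure X) (F : ℕ → X → ℝ≥0∞) : Prop where
  measurable : ∀ k, Measurable (F k)
  setLIntegral : ∀ k {A : Set X}, MeasurableSet A → ∫⁻ x in A, F k x ∂m = ν (T^[k] ⁻¹' A)

/-- The renewal identity behind the proposition: it links the tails of the return time to `B`
with the partial sums of the densities `F k` on `B`. -/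
theorem sum_measure_hitBy (hF : IsDualDensity T m ν F) (hT : Measurable T)
    (hB : MeasurableSet B) (N : ℕ) :
    ∑ n ∈ Finset.range N, ν (hitBy T B n) =
      ∑ l ∈ Finset.range N,
        ∫⁻ x in noReturn T B l, ∑ k ∈ Finset.range (N - l), F k x ∂m := by
  induction N with
  | zero => simp
  | succ N ih =>
    have hstep : ν (hitBy T B N) =
        ∑ l ∈ Finset.range (N + 1), ∫⁻ x in noReturn T B l, F (N - l) x ∂m := by
      rw [measure_hitBy ν hT hB, ← Finset.sum_range_reflect]
      refine Finset.sum_congr rfl fun l hl => ?_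
      have hl' : l ≤ N := by simpa [Nat.lt_succ_iff] using hl
      rw [hF.setLIntegral _ (measurableSet_noReturn hT hB l)]
      simp only [Nat.add_sub_cancel]
      rw [Nat.sub_sub_self hl']
    have hlast : ∑ l ∈ Finset.range N,
        ∫⁻ x in noReturn T B l, ∑ k ∈ Finset.range (N - l), F k x ∂m =
        ∑ l ∈ Finset.range (N + 1),
          ∫⁻ x in noReturn T B l, ∑ k ∈ Finset.range (N - l), F k x ∂m := by
      rw [Finset.sum_range_succ]
      simp
    rw [Finset.sum_range_succ, ih, hstep, hlast, ← Finset.sum_add_distrib]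
    refine Finset.sum_congr rfl fun l hl => ?_
    have hl' : l ≤ N := by simpa [Nat.lt_succ_iff] using hl
    rw [← lintegral_add_right _ (hF.measurable _), Nat.succ_sub hl']
    simp_rw [Finset.sum_range_succ]

/-- If the partial sums of the `F k` are at least `α n` on `B`, then `m (B ∩ {φ_B > n})` is at
most of the order `1 / α n`. -/
theorem measure_noReturn_mul_le (hF : IsDualDensity T m ν F) (hT : Measurable T)
    (hB : MeasurableSet B) {N : ℕ} {α : ℝ≥0∞}
    (hα : ∀ x ∈ B, α ≤ ∑ k ∈ Finset.range (N + 1), F k x) :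
    m (noReturn T B N) * α ≤ 2 * ν Set.univ := by
  -- the renewal identity at `2 N + 1`: its terms with `l ≤ N` involve at least `N + 1` densities
  have h1 : ((N + 1 : ℕ) : ℝ≥0∞) * (m (noReturn T B N) * α) ≤
      ((N + 1 : ℕ) : ℝ≥0∞) * (2 * ν Set.univ) := by
    calc ((N + 1 : ℕ) : ℝ≥0∞) * (m (noReturn T B N) * α)
        = ∑ l ∈ Finset.range (N + 1), m (noReturn T B N) * α := by simp
      _ ≤ ∑ l ∈ Finset.range (N + 1),
            ∫⁻ x in noReturn T B l, ∑ k ∈ Finset.range (2 * N + 1 - l), F k x ∂m := by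
          refine Finset.sum_le_sum fun l hl => ?_
          have hl' : l ≤ N := by simpa [Nat.lt_succ_iff] using hl
          calc m (noReturn T B N) * α ≤ m (noReturn T B l) * α := by
                gcongr
                exact noReturn_anti T B hl'
            _ = ∫⁻ x in noReturn T B l, α ∂m := by rw [setLIntegral_const, mul_comm]
            _ ≤ _ := by
                refine setLIntegral_mono' (measurableSet_noReturn hT hB l) fun x hx => ?_
                refine (hα x hx.1).trans (Finset.sum_le_sum_of_subset ?_)
                exact Finset.range_mono (by omega)
      _ ≤ ∑ l ∈ Finset.range (2 * N + 1),
            ∫⁻ x in noReturn T B l, ∑ k ∈ Finset.range (2 * N + 1 - l), F k x ∂m :=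
          Finset.sum_le_sum_of_subset (Finset.range_mono (by omega))
      _ = ∑ n ∈ Finset.range (2 * N + 1), ν (hitBy T B n) :=
          (sum_measure_hitBy hF hT hB _).symm
      _ ≤ ∑ n ∈ Finset.range (2 * N + 1), ν Set.univ :=
          Finset.sum_le_sum fun n _ => measure_mono (Set.subset_univ _)
      _ = ((2 * N + 1 : ℕ) : ℝ≥0∞) * ν Set.univ := by simp
      _ ≤ ((N + 1 : ℕ) : ℝ≥0∞) * (2 * ν Set.univ) := by
          rw [← mul_assoc]
          gcongr
          have : (2 * N + 1 : ℕ) ≤ (N + 1) * 2 := by omega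
          exact_mod_cast this
  exact (ENNReal.mul_le_mul_iff_right (by simp) (by simp)).1 h1

/-- If the partial sums of the `F k` are at most `α n` on `B`, then the truncated mean return
time `∑_{l ≤ n} m (B ∩ {φ_B > l})` is at least of the order `n / α n`. -/
theorem le_mul_sum_measure_noReturn (hF : IsDualDensity T m ν F) (hT : Measurable T)
    (hB : MeasurableSet B) {n₁ N : ℕ} (hN : 2 * n₁ ≤ N) {α : ℝ≥0∞}
    (hα : ∀ x ∈ B, ∑ k ∈ Finset.range N, F k x ≤ α) :
    (N : ℝ≥0∞) * ν (hitBy T B n₁) ≤ 2 * (α * ∑ l ∈ Finset.range N, m (noReturn T B l)) := by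
  calc (N : ℝ≥0∞) * ν (hitBy T B n₁)
      ≤ 2 * (((N - n₁ : ℕ) : ℝ≥0∞) * ν (hitBy T B n₁)) := by
        rw [← mul_assoc]
        gcongr
        have : N ≤ 2 * (N - n₁) := by omega
        exact_mod_cast this
    _ = 2 * ∑ n ∈ Finset.Ico n₁ N, ν (hitBy T B n₁) := by simp
    _ ≤ 2 * ∑ n ∈ Finset.Ico n₁ N, ν (hitBy T B n) := by
        gcongr with n hn
        exact hitBy_mono T B (Finset.mem_Ico.1 hn).1
    _ ≤ 2 * ∑ n ∈ Finset.range N, ν (hitBy T B n) := by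
        gcongr
        intro n hn
        exact Finset.mem_range.2 (Finset.mem_Ico.1 hn).2
    _ = 2 * ∑ l ∈ Finset.range N,
          ∫⁻ x in noReturn T B l, ∑ k ∈ Finset.range (N - l), F k x ∂m := by
        rw [sum_measure_hitBy hF hT hB]
    _ ≤ 2 * ∑ l ∈ Finset.range N, α * m (noReturn T B l) := by
        gcongr with l hl
        rw [← setLIntegral_const]
        refine setLIntegral_mono' (measurableSet_noReturn hT hB l) fun x hx => ?_
        refine le_trans (Finset.sum_le_sum_of_subset ?_) (hα x hx.1)
        exact Finset.range_mono (by omega)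
    _ = _ := by rw [← Finset.mul_sum]

end Renewal

/-! ### Visits under a conservative ergodic map -/

section Recurrence

variable {X : Type*} [MeasurableSpace X] {T : X → X} {m ν : Measure X} {B : Set X}

/-- Under a conservative ergodic map almost every orbit visits a given set of positive measure. -/
theorem ae_exists_iterate_mem (hc : Conservative T m) (he : Ergodic T m) (hB : MeasurableSet B)
    (hB0 : m B ≠ 0) : ∀ᵐ x ∂m, ∃ j, T^[j] x ∈ B := by
  set G : Set X := limsup (fun n => T^[n] ⁻¹' B) atTop with hG
  have hGm : MeasurableSet G :=
    MeasurableSet.measurableSet_limsup fun n => he.measurable.iterate n hB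
  have hmem : ∀ x, x ∈ G ↔ ∃ᶠ n in atTop, T^[n] x ∈ B := fun x => by
    rw [hG, mem_limsup_iff_frequently_mem]; rfl
  have hinv : T ⁻¹' G = G := by
    ext x
    rw [Set.mem_preimage, hmem, hmem]
    simp only [← Function.iterate_succ_apply]
    have := frequently_map (f := atTop) (m := fun n : ℕ => n + 1) (P := fun n => T^[n] x ∈ B)
    rw [map_add_atTop_eq_nat] at this
    exact this.symm
  rcases he.toPreErgodic.ae_empty_or_univ hGm hinv with h | h
  · refine absurd ?_ hB0
    have h0 : m G = 0 := by simpa using measure_congr h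
    have hsub := hc.ae_mem_imp_frequently_image_mem hB.nullMeasurableSet
    refine measure_mono_null_ae ?_ h0
    filter_upwards [hsub] with x hx hxB
    exact (hmem x).2 (hx hxB)
  · filter_upwards [h.mem_iff] with x hx
    exact ((hmem x).1 (hx.2 trivial)).exists

theorem exists_measure_hitBy_pos (hc : Conservative T m) (he : Ergodic T m)
    (hB : MeasurableSet B) (hB0 : m B ≠ 0) (hν : ν ≪ m) (hν0 : ν Set.univ ≠ 0) :
    ∃ n, ν (hitBy T B n) ≠ 0 := by
  by_contra h
  push Not at h
  have h1 : ν (⋃ n, hitBy T B n) = 0 := measure_iUnion_null h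
  have h2 : ∀ᵐ x ∂ν, x ∈ ⋃ n, hitBy T B n := by
    filter_upwards [hν.ae_le (ae_exists_iterate_mem hc he hB hB0)] with x ⟨j, hj⟩
    exact Set.mem_iUnion.2 ⟨j, j, le_rfl, hj⟩
  refine hν0 ?_
  rw [← h1]
  exact measure_congr (eventuallyEq_univ.2 h2).symm

end Recurrence

/-! ### Dual densities from a return sequence -/

section ReturnSequence

variable {X : Type*} [MeasurableSpace X] {T : X → X} {m ν : Measure X} {A B : Set X}

theorem transfer_congr {f g : X → ℝ} (h : f =ᵐ[m] g) : transfer T m f = transfer T m g := by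
  rw [transfer, transfer, WithDensityᵥEq.congr_ae h]

theorem integrable_iterate_transfer {f : X → ℝ} (hf : Integrable f m) (k : ℕ) :
    Integrable ((transfer T m)^[k] f) m := by
  cases k with
  | zero => exact hf
  | succ k =>
    rw [Function.iterate_succ_apply']
    exact integrable_transfer _ _ _

theorem setIntegral_iterate_transfer [SigmaFinite m] (hT : MeasurePreserving T m m) {f : X → ℝ}
    (hf : Integrable f m) (k : ℕ) {A : Set X} (hA : MeasurableSet A) :
    ∫ x in A, ((transfer T m)^[k] f) x ∂m = ∫ x in T^[k] ⁻¹' A, f x ∂m := by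
  induction k generalizing A with
  | zero => rfl
  | succ k ih =>
    rw [Function.iterate_succ_apply', setIntegral_transfer hT (integrable_iterate_transfer hf k) hA,
      ih (hT.measurable hA), ← Set.preimage_comp, ← Function.iterate_succ']

/-- A return sequence gives a finite measure `ν` with dual densities whose partial sums are
asymptotic to `ν(X) a n` almost everywhere. -/
theorem IsReturnSequence.exists_isDualDensity [SigmaFinite m] (hT : MeasurePreserving T m m)
    {a : ℕ → ℝ} (ha : IsReturnSequence T m a) :
    ∃ (ν : Measure X) (F : ℕ → X → ℝ≥0∞), IsDualDensity T m ν F ∧ ν ≪ m ∧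
      ν Set.univ ≠ 0 ∧ ν Set.univ ≠ ∞ ∧
      ∀ᵐ x ∂m, Tendsto (fun n => (∑ k ∈ Finset.range n, F k x) / ENNReal.ofReal (a n)) atTop
        (𝓝 (ν Set.univ)) := by
  obtain ⟨hpos, f, hf, hf0, hfint, hlim⟩ := ha
  -- `f` is replaced by a measurable version; this does not change its images under `transfer`
  set g := hf.1.mk f with hg
  have hfg : f =ᵐ[m] g := hf.1.ae_eq_mk
  have hgm : Measurable g := hf.1.stronglyMeasurable_mk.measurable
  have hgi : Integrable g m := hf.congr hfg
  have hg0 : 0 ≤ᵐ[m] g := hf0.trans_eq hfg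
  have hiter : ∀ k, (transfer T m)^[k] f =ᵐ[m] (transfer T m)^[k] g := by
    intro k
    cases k with
    | zero => exact hfg
    | succ k => rw [Function.iterate_succ_apply, Function.iterate_succ_apply, transfer_congr hfg]
  have hmeas : ∀ k, Measurable ((transfer T m)^[k] g) := by
    intro k
    cases k with
    | zero => exact hgm
    | succ k =>
      rw [Function.iterate_succ_apply']
      exact SignedMeasure.measurable_rnDeriv _ _
  have hnonneg : ∀ k, 0 ≤ᵐ[m] (transfer T m)^[k] g := by
    intro k
    refine ae_nonneg_of_forall_setIntegral_nonneg (integrable_iterate_transfer hgi k)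
      fun s hs _ => ?_
    rw [setIntegral_iterate_transfer hT hgi k hs]
    exact integral_nonneg_of_ae (ae_restrict_of_ae hg0)
  have hset : ∀ k {A : Set X}, MeasurableSet A →
      ∫⁻ x in A, ENNReal.ofReal (((transfer T m)^[k] g) x) ∂m =
        (m.withDensity fun x => ENNReal.ofReal (g x)) (T^[k] ⁻¹' A) := by
    intro k A hA
    rw [withDensity_apply _ (hT.measurable.iterate k hA),
      ← ofReal_integral_eq_lintegral_ofReal (integrable_iterate_transfer hgi k).restrict
        (ae_restrict_of_ae (hnonneg k)),
      ← ofReal_integral_eq_lintegral_ofReal hgi.restrict (ae_restrict_of_ae hg0),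
      setIntegral_iterate_transfer hT hgi k hA]
  have huniv : (m.withDensity fun x => ENNReal.ofReal (g x)) Set.univ =
      ENNReal.ofReal (∫ x, f x ∂m) := by
    rw [withDensity_apply _ .univ, Measure.restrict_univ, integral_congr_ae hfg,
      ofReal_integral_eq_lintegral_ofReal hgi hg0]
  refine ⟨m.withDensity fun x => ENNReal.ofReal (g x),
    fun k x => ENNReal.ofReal (((transfer T m)^[k] g) x),
    ⟨fun k => (hmeas k).ennreal_ofReal, fun k A hA => hset k hA⟩,
    withDensity_absolutelyContinuous _ _, ?_, ?_, ?_⟩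
  · rw [huniv]; simpa using hfint
  · rw [huniv]; exact ENNReal.ofReal_ne_top
  · rw [huniv]
    filter_upwards [hlim, ae_all_iff.2 hiter, ae_all_iff.2 hnonneg] with x hx hxi hx0
    refine Tendsto.congr' ?_ ((ENNReal.continuous_ofReal.tendsto _).comp hx)
    filter_upwards [eventually_ge_atTop 1] with n hn
    rw [Function.comp_apply, ← ENNReal.ofReal_sum_of_nonneg fun k _ => hx0 k,
      ← ENNReal.ofReal_div_of_pos (hpos n hn), one_div, inv_mul_eq_div]
    simp_rw [hxi]

/-- Almost everywhere convergence is, on a part of positive measure of any given set, uniform to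
within a factor two. -/
theorem exists_uniform_subset {S : ℕ → X → ℝ≥0∞} (hS : ∀ n, Measurable (S n)) {α : ℕ → ℝ≥0∞}
    (hα : ∀ n, 1 ≤ n → α n ≠ 0) (hα' : ∀ n, α n ≠ ∞) {c : ℝ≥0∞} (hc0 : c ≠ 0) (hc : c ≠ ∞)
    (hlim : ∀ᵐ x ∂m, Tendsto (fun n => S n x / α n) atTop (𝓝 c)) (hA : MeasurableSet A)
    (hA0 : m A ≠ 0) :
    ∃ B ⊆ A, MeasurableSet B ∧ m B ≠ 0 ∧ ∃ n₀, ∀ n, n₀ ≤ n → ∀ x ∈ B,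
      c / 2 * α n ≤ S n x ∧ S n x ≤ 2 * c * α n := by
  set E : ℕ → Set X := fun n₀ =>
    A ∩ {x | ∀ n, n₀ ≤ n → c / 2 * α n ≤ S n x ∧ S n x ≤ 2 * c * α n} with hE
  have hEm : ∀ n₀, MeasurableSet (E n₀) := by
    intro n₀
    refine hA.inter ?_
    simp only [Set.ofPred_forall, Set.ofPred_and]
    exact .iInter fun n => .iInter fun _ =>
      (measurableSet_le measurable_const (hS n)).inter (measurableSet_le (hS n) measurable_const)
  have hcover : ∀ᵐ x ∂m, x ∈ A → x ∈ ⋃ n₀, E n₀ := by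
    filter_upwards [hlim] with x hx hxA
    have hlt : c / 2 < c := ENNReal.half_lt_self hc0 hc
    have hgt : c < 2 * c := by
      have := ENNReal.half_lt_self (a := 2 * c) (by simp [hc0])
        (ENNReal.mul_ne_top (by simp) hc)
      rwa [mul_comm, ENNReal.mul_div_cancel_right (by simp) (by simp), mul_comm] at this
    obtain ⟨n₀, hn₀⟩ := eventually_atTop.1
      ((hx.eventually (Ioo_mem_nhds hlt hgt)).and (eventually_ge_atTop 1))
    refine Set.mem_iUnion.2 ⟨n₀, hxA, fun n hn => ?_⟩
    obtain ⟨⟨h1, h2⟩, h3⟩ := hn₀ n hn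
    exact ⟨(ENNReal.le_div_iff_mul_le (.inl (hα n h3)) (.inl (hα' n))).1 h1.le,
      (ENNReal.div_le_iff_le_mul (.inl (hα n h3)) (.inl (hα' n))).1 h2.le⟩
  have hex : ∃ n₀, m (E n₀) ≠ 0 := by
    by_contra h
    push Not at h
    exact hA0 (measure_mono_null_ae hcover (measure_iUnion_null h))
  obtain ⟨n₀, hn₀⟩ := hex
  exact ⟨E n₀, Set.inter_subset_left, hEm n₀, hn₀, n₀, fun n hn x hx => hx.2 n hn⟩

end ReturnSequence

/-! ### Comparison of series -/

section Series

theorem sum_range_inv_sq_le (l n : ℕ) :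
    ∑ i ∈ Finset.range n, (((l : ℝ) + i + 1) ^ 2)⁻¹ ≤ 2 * ((l : ℝ) + 1)⁻¹ := by
  -- telescoping: `1 / x ^ 2 ≤ 1 / (x - 1 / 2) - 1 / (x + 1 / 2)`
  have key : ∑ i ∈ Finset.range n, (((l : ℝ) + i + 1) ^ 2)⁻¹ ≤
      2 * ((l : ℝ) + 1)⁻¹ - ((l : ℝ) + n + 1 / 2)⁻¹ := by
    induction n with
    | zero =>
      have h : 0 ≤ 2 * ((l : ℝ) + 1)⁻¹ - ((l : ℝ) + 1 / 2)⁻¹ := by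
        have : 2 * ((l : ℝ) + 1)⁻¹ - ((l : ℝ) + 1 / 2)⁻¹ =
            l / (((l : ℝ) + 1) * (l + 1 / 2)) := by
          field_simp; ring
        rw [this]; positivity
      simpa using h
    | succ n ih =>
      rw [Finset.sum_range_succ]
      have : (((l : ℝ) + n + 1) ^ 2)⁻¹ ≤
          ((l : ℝ) + n + 1 / 2)⁻¹ - ((l : ℝ) + (n + 1 : ℕ) + 1 / 2)⁻¹ := by
        have h : ((l : ℝ) + n + 1 / 2)⁻¹ - ((l : ℝ) + (n + 1 : ℕ) + 1 / 2)⁻¹ =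
            (((l : ℝ) + n + 1 / 2) * ((l : ℝ) + n + 3 / 2))⁻¹ := by
          push_cast
          field_simp; ring
        rw [h]
        refine inv_anti₀ (by positivity) ?_
        nlinarith
      linarith
  have : (0 : ℝ) ≤ ((l : ℝ) + n + 1 / 2)⁻¹ := by positivity
  linarith

theorem tsum_inv_sq_le (l : ℕ) :
    ∑' i : ℕ, (((l + i : ℕ) + 1 : ℝ≥0∞) ^ 2)⁻¹ ≤ 2 * ((l : ℝ≥0∞) + 1)⁻¹ := by
  rw [ENNReal.tsum_eq_iSup_nat]
  refine iSup_le fun n => ?_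
  have hinv : ∀ y : ℝ, 0 ≤ y → (ENNReal.ofReal y + 1)⁻¹ = ENNReal.ofReal (y + 1)⁻¹ := by
    intro y hy
    rw [ENNReal.ofReal_inv_of_pos (by positivity), ENNReal.ofReal_add hy zero_le_one,
      ENNReal.ofReal_one]
  have h := ENNReal.ofReal_le_ofReal (sum_range_inv_sq_le l n)
  rw [ENNReal.ofReal_sum_of_nonneg (fun i _ => by positivity),
    ENNReal.ofReal_mul (by norm_num), ← hinv l (by positivity)] at h
  simp only [ENNReal.ofReal_natCast, ENNReal.ofReal_ofNat] at h
  refine le_of_eq_of_le (Finset.sum_congr rfl fun i _ => ?_) h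
  rw [← ENNReal.ofReal_natCast, ENNReal.inv_pow, hinv _ (by positivity),
    ← ENNReal.ofReal_pow (by positivity), inv_pow]
  push_cast
  rfl

theorem tsum_sum_range_mul_inv_sq_le (b : ℕ → ℝ≥0∞) :
    ∑' n : ℕ, (∑ l ∈ Finset.range (n + 1), b l) * (((n : ℝ≥0∞) + 1) ^ 2)⁻¹ ≤
      2 * ∑' l : ℕ, b l * ((l : ℝ≥0∞) + 1)⁻¹ := by
  calc ∑' n : ℕ, (∑ l ∈ Finset.range (n + 1), b l) * (((n : ℝ≥0∞) + 1) ^ 2)⁻¹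
      = ∑' n : ℕ, ∑ p ∈ Finset.HasAntidiagonal.antidiagonal n,
          b p.1 * (((p.1 + p.2 : ℕ) + 1 : ℝ≥0∞) ^ 2)⁻¹ := by
        refine tsum_congr fun n => ?_
        rw [Finset.Nat.sum_antidiagonal_eq_sum_range_succ (fun l i =>
          b l * (((l + i : ℕ) + 1 : ℝ≥0∞) ^ 2)⁻¹), Finset.sum_mul]
        refine Finset.sum_congr rfl fun l hl => ?_
        rw [Nat.add_sub_cancel' (by simpa [Nat.lt_succ_iff] using hl)]
    _ = ∑' l : ℕ, ∑' i : ℕ, b l * (((l + i : ℕ) + 1 : ℝ≥0∞) ^ 2)⁻¹ :=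
        tsum_sum_antidiagonal fun l i => b l * (((l + i : ℕ) + 1 : ℝ≥0∞) ^ 2)⁻¹
    _ ≤ ∑' l : ℕ, 2 * (b l * ((l : ℝ≥0∞) + 1)⁻¹) := by
        refine ENNReal.tsum_le_tsum fun l => ?_
        rw [ENNReal.tsum_mul_left, mul_left_comm]
        gcongr
        exact tsum_inv_sq_le l
    _ = _ := ENNReal.tsum_mul_left

/-- A series of finite terms in `[0, ∞]` that is eventually dominated by a convergent one
converges. -/
theorem tsum_lt_top_of_eventually_le {u v : ℕ → ℝ≥0∞} (hu : ∀ n, u n ≠ ∞) {n₀ : ℕ}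
    (h : ∀ n, n₀ ≤ n → u n ≤ v n) (hv : ∑' n, v n < ∞) : ∑' n, u n < ∞ := by
  calc ∑' n, u n ≤ ∑' n, ((if n < n₀ then u n else 0) + v n) := by
        refine ENNReal.tsum_le_tsum fun n => ?_
        by_cases hn : n < n₀
        · simp [hn]
        · simpa [hn] using h n (not_lt.1 hn)
    _ = ∑' n, (if n < n₀ then u n else 0) + ∑' n, v n := ENNReal.tsum_add
    _ < ∞ := by
        refine ENNReal.add_lt_top.2 ⟨?_, hv⟩
        rw [tsum_eq_sum (s := Finset.range n₀) fun n hn => by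
          simp [not_lt.1 (fun h => hn (Finset.mem_range.2 h))]]
        refine ENNReal.sum_lt_top.2 fun n _ => ?_
        split_ifs
        · exact (hu n).lt_top
        · simp

theorem summable_inv_mul_iff {a : ℕ → ℝ} (ha : ∀ n, 1 ≤ n → 0 < a n) :
    (Summable fun n : ℕ => 1 / (((n + 1 : ℕ) : ℝ) * a (n + 1))) ↔
      ∑' n : ℕ, (ENNReal.ofReal (a (n + 1)))⁻¹ * ((n : ℝ≥0∞) + 1)⁻¹ < ∞ := by
  have h : ∀ n : ℕ, (ENNReal.ofReal (a (n + 1)))⁻¹ * ((n : ℝ≥0∞) + 1)⁻¹ =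
      ENNReal.ofReal (1 / (((n + 1 : ℕ) : ℝ) * a (n + 1))) := by
    intro n
    have hp := ha (n + 1) (by omega)
    rw [one_div, mul_inv, ENNReal.ofReal_mul (by positivity), ENNReal.ofReal_inv_of_pos hp,
      ENNReal.ofReal_inv_of_pos (by positivity), ENNReal.ofReal_natCast, mul_comm]
    simp
  simp_rw [h]
  constructor
  · exact fun hs => hs.tsum_ofReal_lt_top
  · intro hs
    refine (ENNReal.summable_toReal hs.ne).congr fun n => ?_
    have hp := ha (n + 1) (by omega)
    rw [ENNReal.toReal_ofReal (by positivity)]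

end Series

/-! ### The criterion for log-lower boundedness -/

/-- A conservative ergodic map with return sequence `a` is log-lower bounded if and only if
`∑ 1 / (n a n)` converges. -/
theorem isLLB_iff_summable {X : Type*} [MeasurableSpace X] {m : Measure X} [SigmaFinite m]
    {T : X → X} (hcons : Conservative T m) (herg : Ergodic T m) {a : ℕ → ℝ}
    (ha : IsReturnSequence T m a) :
    IsLLB T m ↔ Summable fun n : ℕ => 1 / (((n + 1 : ℕ) : ℝ) * a (n + 1)) := by
  have hT : MeasurePreserving T m m := herg.toMeasurePreserving
  obtain ⟨ν, F, hF, hac, hc0, hc, hlim⟩ := ha.exists_isDualDensity hT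
  set α : ℕ → ℝ≥0∞ := fun n => ENNReal.ofReal (a n) with hα
  have hα0 : ∀ n, 1 ≤ n → α n ≠ 0 := fun n hn => by simpa [hα] using ha.1 n hn
  have hα1 : ∀ n, α n ≠ ∞ := fun n => ENNReal.ofReal_ne_top
  have hSm : ∀ n, Measurable fun x => ∑ k ∈ Finset.range n, F k x := fun n =>
    Finset.measurable_sum _ fun k _ => hF.measurable k
  rw [summable_inv_mul_iff ha.1]
  set c := ν Set.univ with hcdef
  constructor
  · rintro ⟨A, hA, hA0, hAfin, hAlog⟩
    obtain ⟨B, hBA, hB, hB0, n₀, hn₀⟩ :=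
      exists_uniform_subset hSm hα0 hα1 hc0 hc hlim hA hA0.ne'
    have hser : returnSeries T m B < ∞ :=
      (returnSeries_le_of_subset hT hA hB hBA).trans_lt
        ((lintegral_log_returnTime_lt_top_iff hT.measurable hA hAfin).1 hAlog)
    obtain ⟨n₁, hn₁⟩ := exists_measure_hitBy_pos hcons herg hB hB0 hac hc0
    set d := ν (hitBy T B n₁) with hd
    have hd' : d ≠ ∞ := ((measure_mono (Set.subset_univ _)).trans_lt hc.lt_top).ne
    -- the renewal identity gives `(n + 1) d ≤ 4 c a (n + 1) ∑_{l ≤ n} m(R l)`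
    refine tsum_lt_top_of_eventually_le (n₀ := max n₀ (2 * n₁))
      (v := fun n => (4 * c / d) *
        ((∑ l ∈ Finset.range (n + 1), m (noReturn T B l)) * (((n : ℝ≥0∞) + 1) ^ 2)⁻¹))
      (fun n => ENNReal.mul_ne_top (ENNReal.inv_ne_top.2 (hα0 _ (by omega))) (by simp)) ?_ ?_
    · intro n hn
      have h := le_mul_sum_measure_noReturn hF hT.measurable hB (n₁ := n₁) (N := n + 1)
        (by have := le_of_max_le_right hn; omega) (α := 2 * c * α (n + 1))
        fun x hx => (hn₀ (n + 1) (by have := le_of_max_le_left hn; omega) x hx).2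
      set M := ∑ l ∈ Finset.range (n + 1), m (noReturn T B l) with hM
      have hn1 : ((n : ℝ≥0∞) + 1) ≠ 0 := by simp
      have hn2 : ((n : ℝ≥0∞) + 1) ≠ ∞ := by simp
      have hαn := hα0 (n + 1) (by omega)
      have hαn' := hα1 (n + 1)
      push_cast at h
      set y : ℝ≥0∞ := (n : ℝ≥0∞) + 1 with hy
      have hy2 : (y ^ 2)⁻¹ = y⁻¹ * y⁻¹ := by rw [ENNReal.inv_pow, pow_two]
      calc (α (n + 1))⁻¹ * y⁻¹
          = (α (n + 1))⁻¹ * y⁻¹ * (y * d) * (y⁻¹ * d⁻¹) := by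
            rw [mul_assoc (_ * _), mul_mul_mul_comm y, ENNReal.mul_inv_cancel hn1 hn2,
              ENNReal.mul_inv_cancel hn₁ hd', one_mul, mul_one]
        _ ≤ (α (n + 1))⁻¹ * y⁻¹ * (2 * (2 * c * α (n + 1) * M)) * (y⁻¹ * d⁻¹) := by gcongr
        _ = (α (n + 1) * (α (n + 1))⁻¹) * (4 * c * d⁻¹ * (M * (y⁻¹ * y⁻¹))) := by ring
        _ = 4 * c / d * (M * (y ^ 2)⁻¹) := by
            rw [ENNReal.mul_inv_cancel hαn hαn', one_mul, hy2, ENNReal.div_eq_inv_mul,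
              mul_comm d⁻¹]
    · rw [ENNReal.tsum_mul_left]
      refine ENNReal.mul_lt_top (ENNReal.div_lt_top (ENNReal.mul_ne_top (by simp) hc) hn₁) ?_
      exact (tsum_sum_range_mul_inv_sq_le _).trans_lt (ENNReal.mul_lt_top (by simp) hser)
  · intro hsum
    -- any set of positive finite measure contains a suitable set `B`
    have hm0 : m ≠ 0 := by
      rintro rfl
      exact hc0 (hac (by simp))
    obtain ⟨A, hA, hA0, hAfin⟩ : ∃ A, MeasurableSet A ∧ m A ≠ 0 ∧ m A < ∞ := by
      by_contra! h
      refine hm0 (Measure.measure_univ_eq_zero.1 ?_)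
      rw [← iUnion_spanningSets m]
      refine measure_iUnion_null fun n => ?_
      by_contra hn
      exact absurd (measure_spanningSets_lt_top m n)
        (not_lt.2 (h _ (measurableSet_spanningSets m n) hn))
    obtain ⟨B, hBA, hB, hB0, n₀, hn₀⟩ :=
      exists_uniform_subset hSm hα0 hα1 hc0 hc hlim hA hA0
    have hBfin : m B < ∞ := (measure_mono hBA).trans_lt hAfin
    refine ⟨B, hB, pos_iff_ne_zero.2 hB0, hBfin,
      (lintegral_log_returnTime_lt_top_iff hT.measurable hB hBfin).2 ?_⟩
    refine tsum_lt_top_of_eventually_le (n₀ := n₀)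
      (v := fun n => 4 * ((α (n + 1))⁻¹ * ((n : ℝ≥0∞) + 1)⁻¹))
      (fun n => ENNReal.mul_ne_top
        ((measure_mono (noReturn_subset T B n)).trans_lt hBfin).ne (by simp)) ?_ ?_
    · intro n hn
      have h := measure_noReturn_mul_le hF hT.measurable hB (N := n) (α := c / 2 * α (n + 1))
        fun x hx => (hn₀ (n + 1) (by omega) x hx).1
      rw [← mul_assoc]
      gcongr
      have hαn := hα0 (n + 1) (by omega)
      have hαn' := hα1 (n + 1)
      rw [div_eq_mul_inv] at h
      calc m (noReturn T B n)
          = m (noReturn T B n) * ((c * c⁻¹) * (2 * 2⁻¹) * (α (n + 1) * (α (n + 1))⁻¹)) := by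
            rw [ENNReal.mul_inv_cancel hc0 hc, ENNReal.mul_inv_cancel (by simp) (by simp),
              ENNReal.mul_inv_cancel hαn hαn', one_mul, one_mul, mul_one]
        _ = m (noReturn T B n) * (c * 2⁻¹ * α (n + 1)) * (2 * c⁻¹ * (α (n + 1))⁻¹) := by ring
        _ ≤ 2 * c * (2 * c⁻¹ * (α (n + 1))⁻¹) := by gcongr
        _ = (c * c⁻¹) * (4 * (α (n + 1))⁻¹) := by ring
        _ = 4 * (α (n + 1))⁻¹ := by rw [ENNReal.mul_inv_cancel hc0 hc, one_mul]
    · rw [ENNReal.tsum_mul_left]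
      exact ENNReal.mul_lt_top (by simp) hsum

/-! ### The path space of an i.i.d. sequence -/

section PathSpace

variable {G : Type*}

/-- The path that starts with `e` and continues with `w`. -/
def pathCons (e : G) (w : ℕ → G) : ℕ → G
  | 0 => e
  | n + 1 => w n

theorem pathCons_shift (w : ℕ → G) : pathCons (w 0) (shift w) = w := by
  funext n
  cases n <;> rfl

variable [MeasurableSpace G]

theorem measurable_pathCons_uncurry :
    Measurable fun q : G × (ℕ → G) => pathCons q.1 q.2 := by
  refine measurable_pi_lambda _ fun n => ?_
  cases n with
  | zero => exact measurable_fst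
  | succ n => exact (measurable_pi_apply n).comp measurable_snd

theorem measurable_shift : Measurable (shift : (ℕ → G) → ℕ → G) :=
  measurable_pi_lambda _ fun n => measurable_pi_apply (n + 1)

/-- An independent first coordinate put in front of an i.i.d. sequence gives the same i.i.d.
sequence. -/
theorem map_pathCons_prod_infinitePi (μ : Measure G) [IsProbabilityMeasure μ] :
    (μ.prod (Measure.infinitePi fun _ : ℕ => μ)).map (fun q => pathCons q.1 q.2) =
      Measure.infinitePi fun _ : ℕ => μ := by
  classical
  refine Measure.eq_infinitePi _ fun s t ht => ?_
  set t' : ℕ → Set G := fun i => if i ∈ s then t i else Set.univ with ht'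
  have ht'm : ∀ i, MeasurableSet (t' i) := by
    intro i
    simp only [ht']
    split_ifs
    exacts [ht i, .univ]
  obtain ⟨N, hN⟩ : ∃ N, s ⊆ Finset.range (N + 1) :=
    ⟨s.sup id, fun i hi => Finset.mem_range.2 (Nat.lt_succ_of_le (Finset.le_sup (f := id) hi))⟩
  have hpi : Set.pi (s : Set ℕ) t = Set.pi (Finset.range (N + 1) : Set ℕ) t' := by
    ext w
    simp only [Set.mem_pi, Finset.mem_coe, ht']
    constructor
    · intro h i _
      split_ifs with hi
      exacts [h i hi, trivial]
    · intro h i hi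
      simpa [hi] using h i (hN hi)
  have hprod : ∏ i ∈ s, μ (t i) = ∏ i ∈ Finset.range (N + 1), μ (t' i) := by
    rw [← Finset.prod_subset hN (f := fun i => μ (t' i))]
    · exact Finset.prod_congr rfl fun i hi => by simp [ht', hi]
    · intro i _ hi
      simp [ht', hi]
  have hpre : (fun q : G × (ℕ → G) => pathCons q.1 q.2) ⁻¹'
      Set.pi (Finset.range (N + 1) : Set ℕ) t' =
        t' 0 ×ˢ Set.pi (Finset.range N : Set ℕ) fun i => t' (i + 1) := by
    ext ⟨e, w⟩
    simp only [Set.mem_preimage, Set.mem_pi, Finset.mem_coe, Finset.mem_range, Set.mem_prod]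
    constructor
    · exact fun h => ⟨h 0 (Nat.succ_pos N), fun i hi => h (i + 1) (by omega)⟩
    · rintro ⟨h0, h1⟩ i hi
      cases i with
      | zero => exact h0
      | succ i => exact h1 i (by omega)
  rw [hprod, hpi, Measure.map_apply measurable_pathCons_uncurry
    (.pi (Finset.countable_toSet _) fun i _ => ht'm i), hpre, Measure.prod_prod,
    Measure.infinitePi_pi _ fun i _ => ht'm (i + 1), Finset.prod_range_succ', mul_comm]

end PathSpace

/-! ### The Markov property and conservativity of random walks -/

section Walk

variable {G : Type*} [AddCommGroup G]

theorem shift_walkPath_pathCons (x e : G) (ξ : ℕ → G) :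
    shift (walkPath x (pathCons e ξ)) = walkPath (x + e) ξ := by
  funext n
  simp only [shift, walkPath, Finset.sum_range_succ', pathCons]
  abel

variable [MeasurableSpace G] [Countable G] [MeasurableSingletonClass G] (p : PMF G)

theorem measurable_walkPath (x : G) : Measurable (walkPath x) := by
  refine measurable_pi_lambda _ fun n => ?_
  simp only [walkPath]
  fun_prop

instance isProbabilityMeasure_walkLaw (x : G) : IsProbabilityMeasure (walkLaw p x) :=
  Measure.isProbabilityMeasure_map (measurable_walkPath x).aemeasurable

omit [AddCommGroup G] [Countable G] in
theorem measurableSet_zero_eq (x : G) : MeasurableSet {w : ℕ → G | w 0 = x} :=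
  (measurable_pi_apply 0 : Measurable fun w : ℕ → G => w 0) (measurableSet_singleton x)

theorem ae_walkLaw_zero_eq (x : G) : ∀ᵐ w ∂(walkLaw p x), w 0 = x := by
  rw [walkLaw, ae_map_iff (measurable_walkPath x).aemeasurable (measurableSet_zero_eq x)]
  exact .of_forall fun ξ => by simp [walkPath]

/-- The Markov property at time one. -/
theorem walkLaw_preimage_shift (x : G) {E : Set (ℕ → G)} (hE : MeasurableSet E) :
    walkLaw p x (shift ⁻¹' E) = ∑' e, p e * walkLaw p (x + e) E := by
  have hpre : (fun q : G × (ℕ → G) => pathCons q.1 q.2) ⁻¹' (walkPath x ⁻¹' (shift ⁻¹' E)) =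
      {q : G × (ℕ → G) | walkPath (x + q.1) q.2 ∈ E} := by
    ext q
    simp [shift_walkPath_pathCons]
  have hm : MeasurableSet (walkPath x ⁻¹' (shift ⁻¹' E)) :=
    measurable_walkPath x (measurable_shift hE)
  have hm' : MeasurableSet {q : G × (ℕ → G) | walkPath (x + q.1) q.2 ∈ E} := by
    rw [← hpre]
    exact measurable_pathCons_uncurry hm
  rw [walkLaw, Measure.map_apply (measurable_walkPath x) (measurable_shift hE),
    ← map_pathCons_prod_infinitePi, Measure.map_apply measurable_pathCons_uncurry hm, hpre,
    Measure.prod_apply hm', lintegral_countable']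
  refine tsum_congr fun e => ?_
  rw [PMF.toMeasure_apply_singleton _ _ (measurableSet_singleton e), mul_comm, walkLaw,
    Measure.map_apply (measurable_walkPath _) hE]
  rfl

open Classical in
/-- The probability `p_k(y)` that the walk started at `0` is at `y` at time `k`. -/
noncomputable def stepProb (p : PMF G) : ℕ → G → ℝ≥0∞
  | 0, y => if y = 0 then 1 else 0
  | k + 1, y => ∑' e, p e * stepProb p k (y - e)

omit [MeasurableSpace G] [Countable G] [MeasurableSingletonClass G] in
theorem stepProb_le_one (k : ℕ) (y : G) : stepProb p k y ≤ 1 := by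
  induction k generalizing y with
  | zero => rw [stepProb]; split_ifs <;> simp
  | succ k ih =>
    rw [stepProb]
    calc ∑' e, p e * stepProb p k (y - e) ≤ ∑' e, p e * 1 := by
          gcongr with e; exact ih _
      _ = 1 := by simp [p.tsum_coe]

/-- The Markov property at time `k`. -/
theorem walkLaw_preimage_iterate_shift (k : ℕ) (x : G) {E : Set (ℕ → G)}
    (hE : MeasurableSet E) :
    walkLaw p x (shift^[k] ⁻¹' E) = ∑' y, stepProb p k y * walkLaw p (x + y) E := by
  induction k generalizing E with
  | zero =>
    rw [tsum_eq_single 0 fun y hy => by simp [stepProb, hy]]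
    simp [stepProb]
  | succ k ih =>
    have hpre : shift^[k + 1] ⁻¹' E = shift^[k] ⁻¹' (shift ⁻¹' E) := by
      rw [← Set.preimage_comp, ← Function.iterate_succ']
    rw [hpre, ih (measurable_shift hE)]
    calc ∑' y, stepProb p k y * walkLaw p (x + y) (shift ⁻¹' E)
        = ∑' y, ∑' e, p e * (stepProb p k y * walkLaw p (x + (y + e)) E) := by
          refine tsum_congr fun y => ?_
          rw [walkLaw_preimage_shift p _ hE, ← ENNReal.tsum_mul_left]
          refine tsum_congr fun e => ?_
          rw [add_assoc, mul_left_comm]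
      _ = ∑' e, ∑' z, p e * (stepProb p k (z - e) * walkLaw p (x + z) E) := by
          rw [ENNReal.tsum_comm]
          refine tsum_congr fun e => ?_
          rw [← (Equiv.addRight e).tsum_eq
            fun z => p e * (stepProb p k (z - e) * walkLaw p (x + z) E)]
          simp
      _ = ∑' z, stepProb p (k + 1) z * walkLaw p (x + z) E := by
          rw [ENNReal.tsum_comm]
          refine tsum_congr fun z => ?_
          rw [stepProb, ← ENNReal.tsum_mul_right]
          simp_rw [mul_assoc]

theorem measurePreserving_shift :
    MeasurePreserving shift (walkMeasure p) (walkMeasure p) := by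
  refine ⟨measurable_shift, Measure.ext fun E hE => ?_⟩
  rw [Measure.map_apply measurable_shift hE, walkMeasure,
    Measure.sum_apply _ (measurable_shift hE), Measure.sum_apply _ hE]
  simp_rw [walkLaw_preimage_shift p _ hE]
  rw [ENNReal.tsum_comm]
  have h : ∀ e, ∑' x, p e * walkLaw p (x + e) E = p e * ∑' x, walkLaw p x E := by
    intro e
    rw [ENNReal.tsum_mul_left, ← (Equiv.addRight e).tsum_eq fun x => walkLaw p x E]
    rfl
  simp_rw [h]
  rw [ENNReal.tsum_mul_right, p.tsum_coe, one_mul]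

theorem setLIntegral_walkMeasure (g : G → ℝ≥0∞) {A : Set (ℕ → G)} (hA : MeasurableSet A) :
    ∫⁻ w in A, g (w 0) ∂(walkMeasure p) = ∑' x, g x * walkLaw p x A := by
  rw [walkMeasure, Measure.restrict_sum _ hA, lintegral_sum_measure]
  refine tsum_congr fun x => ?_
  rw [← setLIntegral_const]
  refine lintegral_congr_ae (ae_restrict_of_ae ?_)
  filter_upwards [ae_walkLaw_zero_eq p x] with w hw
  rw [hw]

instance sigmaFinite_walkMeasure : SigmaFinite (walkMeasure p) := by
  classical
  have hfin : ∀ x : G, walkMeasure p {w | w 0 = x} < ∞ := by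
    intro x
    rw [walkMeasure, Measure.sum_apply _ (measurableSet_zero_eq x), tsum_eq_single x]
    · exact measure_lt_top _ _
    · intro y hy
      refine measure_mono_null_ae (t := ∅) ?_ measure_empty
      filter_upwards [ae_walkLaw_zero_eq p y] with w hw hwx
      exact hy (hw.symm.trans hwx)
  refine ⟨⟨⟨fun n => ⋃ x ∈ {x : G | (exists_injective_nat G).choose x = n}, {w | w 0 = x},
    fun _ => trivial, fun n => ?_, ?_⟩⟩⟩
  · have hs : {x : G | (exists_injective_nat G).choose x = n}.Subsingleton := fun a ha b hb =>
      (exists_injective_nat G).choose_spec (ha.trans hb.symm)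
    rcases hs.eq_empty_or_singleton with h | ⟨x, h⟩
    · simp [h]
    · rw [h]; simpa using hfin x
  · refine Set.eq_univ_of_forall fun w => ?_
    simp

/-- A walk whose Green function is infinite at `0` has a conservative shift: a wandering set `W`
satisfies `∑ p_k(0) P_x(W) ≤ 1` for every `x`. -/
theorem conservative_shift (hrec : ∑' k, stepProb p k 0 = ∞) :
    Conservative shift (walkMeasure p) := by
  refine ⟨(measurePreserving_shift p).quasiMeasurePreserving, fun W hW hW0 => ?_⟩
  by_contra! hwand
  refine hW0 ?_
  rw [walkMeasure, Measure.sum_apply _ hW, ENNReal.tsum_eq_zero]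
  intro x
  have hdisj : Pairwise (Function.onFun Disjoint fun k => shift^[k] ⁻¹' W) := by
    have key : ∀ i j : ℕ, i < j → Disjoint (shift^[i] ⁻¹' W) (shift^[j] ⁻¹' W) := by
      intro i j hij
      refine Set.disjoint_left.2 fun w hi hj => ?_
      refine hwand _ hi (j - i) (by omega) ?_
      rw [← Function.iterate_add_apply, Nat.sub_add_cancel hij.le]
      exact hj
    intro i j hij
    rcases lt_or_gt_of_ne hij with h | h
    exacts [key i j h, (key j i h).symm]
  have hle : (∑' k, stepProb p k 0) * walkLaw p x W ≤ 1 := by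
    rw [← ENNReal.tsum_mul_right]
    calc ∑' k, stepProb p k 0 * walkLaw p x W
        ≤ ∑' k, walkLaw p x (shift^[k] ⁻¹' W) := by
          refine ENNReal.tsum_le_tsum fun k => ?_
          rw [walkLaw_preimage_iterate_shift p k x hW]
          simpa using ENNReal.le_tsum (f := fun y => stepProb p k y * walkLaw p (x + y) W) 0
      _ = walkLaw p x (⋃ k, shift^[k] ⁻¹' W) :=
          (measure_iUnion hdisj fun k => measurable_shift.iterate k hW).symm
      _ ≤ 1 := prob_le_one
  by_contra h
  rw [hrec, ENNReal.top_mul h] at hle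
  simp at hle

end Walk

/-! ### Ergodicity of random walks -/

section Ergodicity

/-- A bounded harmonic function does not increase along a possible step `e` of the walk. If the
supremum `M` of the increments `h (x + e) - h x` were positive, then, the increments being
harmonic, a point where the increment is very close to `M` would be followed by many points
`x + i • e` with increments above `M / 2`, and `h` would be unbounded. -/
theorem harmonic_add_le {G : Type*} [AddCommGroup G] {q h : G → ℝ} (hq : HasSum q 1)
    (hq0 : ∀ y, 0 ≤ q y) (h0 : ∀ x, 0 ≤ h x) (h1 : ∀ x, h x ≤ 1)
    (hh : ∀ x, HasSum (fun y => q y * h (x + y)) (h x)) {e : G} (he : 0 < q e) (x : G) :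
    h (x + e) ≤ h x := by
  set g : G → ℝ := fun x => h (x + e) - h x with hg
  have hg1 : ∀ x, g x ≤ 1 := fun x => by have := h1 (x + e); have := h0 x; simp only [hg]; linarith
  have hbdd : BddAbove (Set.range g) := ⟨1, by rintro _ ⟨x, rfl⟩; exact hg1 x⟩
  set M := ⨆ x, g x with hM
  have hgM : ∀ x, g x ≤ M := le_ciSup hbdd
  have hgsum : ∀ x, HasSum (fun y => q y * (M - g (x + y))) (M - g x) := by
    intro x
    have hs := (hq.mul_right M).sub ((hh (x + e)).sub (hh x))
    rw [one_mul] at hs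
    refine hs.congr_fun fun y => ?_
    simp only [hg, add_right_comm x e y]
    ring
  have hstep : ∀ x, q e * (M - g (x + e)) ≤ M - g x := fun x =>
    le_hasSum (hgsum x) e fun y _ => mul_nonneg (hq0 y) (sub_nonneg.2 (hgM _))
  have hiter : ∀ (i : ℕ) x, q e ^ i * (M - g (x + i • e)) ≤ M - g x := by
    intro i
    induction i with
    | zero => intro x; simp
    | succ i ih =>
      intro x
      calc q e ^ (i + 1) * (M - g (x + (i + 1) • e))
          = q e ^ i * (q e * (M - g (x + i • e + e))) := by
            rw [succ_nsmul, add_assoc]; ring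
        _ ≤ q e ^ i * (M - g (x + i • e)) :=
            mul_le_mul_of_nonneg_left (hstep _) (by positivity)
        _ ≤ M - g x := ih x
  by_contra! hlt
  have hMpos : 0 < M := lt_of_lt_of_le (sub_pos.2 hlt) (hgM x)
  have hqle : q e ≤ 1 := le_hasSum hq e fun y _ => hq0 y
  obtain ⟨J, hJ⟩ := exists_nat_gt (2 / M)
  obtain ⟨x₀, hx₀⟩ := exists_lt_of_lt_ciSup (show M - M / 2 * q e ^ J < ⨆ x, g x by
    have : 0 < M / 2 * q e ^ J := by positivity
    linarith)
  have hlow : ∀ i ∈ Finset.range J, M / 2 ≤ g (x₀ + i • e) := by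
    intro i hi
    have hi' : i ≤ J := (Finset.mem_range.1 hi).le
    have h2 : q e ^ i * (M - g (x₀ + i • e)) ≤ q e ^ i * (M / 2) := by
      calc q e ^ i * (M - g (x₀ + i • e)) ≤ M - g x₀ := hiter i x₀
        _ ≤ q e ^ J * (M / 2) := by linarith
        _ ≤ q e ^ i * (M / 2) :=
            mul_le_mul_of_nonneg_right (pow_le_pow_of_le_one he.le hqle hi') (by positivity)
    have := le_of_mul_le_mul_left h2 (by positivity)
    linarith
  have htel : ∑ i ∈ Finset.range J, g (x₀ + i • e) = h (x₀ + J • e) - h x₀ := by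
    have := Finset.sum_range_sub (fun i : ℕ => h (x₀ + i • e)) J
    simp only [zero_nsmul, add_zero] at this
    rw [← this]
    refine Finset.sum_congr rfl fun i _ => ?_
    rw [hg, succ_nsmul]
    simp only [add_assoc]
  have hsum := Finset.sum_le_sum hlow
  rw [htel, Finset.sum_const, Finset.card_range, nsmul_eq_mul] at hsum
  have hJ' : 2 < J * M := by rwa [div_lt_iff₀ hMpos] at hJ
  have := h1 (x₀ + J • e)
  have := h0 x₀
  linarith

/-- **Liouville property**: bounded harmonic functions of a random walk are constant if the
possible steps generate the group. -/
theorem harmonic_const {G : Type*} [AddCommGroup G] {q h : G → ℝ} (hq : HasSum q 1)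
    (hq0 : ∀ y, 0 ≤ q y) (h0 : ∀ x, 0 ≤ h x) (h1 : ∀ x, h x ≤ 1)
    (hh : ∀ x, HasSum (fun y => q y * h (x + y)) (h x))
    (hgen : AddSubmonoid.closure {e | q e ≠ 0} = ⊤) (x y : G) : h x = h y := by
  have hstep : ∀ e, q e ≠ 0 → ∀ x, h (x + e) = h x := by
    intro e he x
    have hpos : 0 < q e := lt_of_le_of_ne (hq0 e) he.symm
    refine le_antisymm (harmonic_add_le hq hq0 h0 h1 hh hpos x) ?_
    have := harmonic_add_le (h := fun x => 1 - h x) hq hq0 (fun x => sub_nonneg.2 (h1 x))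
      (fun x => by linarith [h0 x])
      (fun x => by
        refine (hq.sub (hh x)).congr_fun fun y => ?_
        ring) hpos x
    linarith
  have hall : ∀ z : G, ∀ x, h (x + z) = h x := by
    intro z
    have hz : z ∈ AddSubmonoid.closure {e | q e ≠ 0} := hgen ▸ trivial
    induction hz using AddSubmonoid.closure_induction with
    | mem e he => exact hstep e he
    | zero => simp
    | add a b _ _ ha hb => intro x; rw [← add_assoc, hb, ha]
  rw [← hall (y - x) x, add_sub_cancel]

variable {G : Type*} [AddCommGroup G] [MeasurableSpace G] [Countable G]
  [MeasurableSingletonClass G] (p : PMF G)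

/-- The probability of a shift-invariant event does not depend on the starting point. -/
theorem walkLaw_eq_of_invariant (hgen : AddSubmonoid.closure {e | p e ≠ 0} = ⊤)
    {E : Set (ℕ → G)} (hE : MeasurableSet E) (hinv : shift ⁻¹' E = E) (x y : G) :
    walkLaw p x E = walkLaw p y E := by
  have hp : HasSum (fun e => (p e).toReal) 1 := by
    have := ENNReal.hasSum_toReal (f := p) p.tsum_coe_ne_top
    rwa [← ENNReal.tsum_toReal_eq p.apply_ne_top, p.tsum_coe, ENNReal.toReal_one] at this
  have key := harmonic_const (q := fun e => (p e).toReal)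
    (h := fun x => (walkLaw p x E).toReal) hp (fun _ => ENNReal.toReal_nonneg)
    (fun _ => ENNReal.toReal_nonneg)
    (fun x => ENNReal.toReal_le_of_le_ofReal zero_le_one (by simpa using prob_le_one)) ?_ ?_ x y
  · exact (ENNReal.toReal_eq_toReal_iff' (measure_ne_top _ _) (measure_ne_top _ _)).1 key
  · intro x
    have hx := walkLaw_preimage_shift p x hE
    rw [hinv] at hx
    have hne : ∑' e, p e * walkLaw p (x + e) E ≠ ∞ := hx ▸ measure_ne_top _ _
    have := ENNReal.hasSum_toReal hne
    rw [← ENNReal.tsum_toReal_eq fun e => ENNReal.ne_top_of_tsum_ne_top hne e, ← hx] at this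
    simpa only [ENNReal.toReal_mul] using this
  · convert hgen using 3
    ext e
    simp [ENNReal.toReal_eq_zero_iff, p.apply_ne_top]

/-- A shift-invariant event of constant probability is independent of every event that depends
on finitely many coordinates. -/
theorem walkLaw_inter_of_dependsOn {E : Set (ℕ → G)} (hE : MeasurableSet E)
    (hinv : shift ⁻¹' E = E) {c : ℝ≥0∞} (hc : ∀ x, walkLaw p x E = c) (n : ℕ)
    {C : Set (ℕ → G)} (hC : MeasurableSet C)
    (hdep : ∀ w w' : ℕ → G, (∀ i < n, w i = w' i) → (w ∈ C ↔ w' ∈ C)) (x : G) :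
    walkLaw p x (E ∩ C) = c * walkLaw p x C := by
  induction n generalizing C x with
  | zero =>
    rcases C.eq_empty_or_nonempty with rfl | ⟨w, hw⟩
    · simp
    · have : C = Set.univ :=
        Set.eq_univ_of_forall fun w' => (hdep w w' (by simp)).1 hw
      simp [this, hc]
  | succ n ih =>
    set C' : Set (ℕ → G) := {w | pathCons x w ∈ C} with hC'
    have hC'm : MeasurableSet C' :=
      (measurable_pathCons_uncurry.comp (measurable_const.prodMk measurable_id)) hC
    have hdep' : ∀ w w' : ℕ → G, (∀ i < n, w i = w' i) → (w ∈ C' ↔ w' ∈ C') := by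
      intro w w' h
      refine hdep _ _ fun i hi => ?_
      cases i with
      | zero => rfl
      | succ i => exact h i (by omega)
    have hmem : ∀ᵐ w ∂(walkLaw p x), (w ∈ C ↔ shift w ∈ C') := by
      filter_upwards [ae_walkLaw_zero_eq p x] with w hw
      rw [hC', Set.mem_ofPred_eq, ← hw, pathCons_shift]
    have hC1 : walkLaw p x C = walkLaw p x (shift ⁻¹' C') := by
      refine measure_congr ?_
      filter_upwards [hmem] with w hw
      exact propext hw
    have hC2 : walkLaw p x (E ∩ C) = walkLaw p x (shift ⁻¹' (E ∩ C')) := by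
      refine measure_congr ?_
      filter_upwards [hmem] with w hw
      refine propext ?_
      have hEw : w ∈ E ↔ shift w ∈ E := by
        conv_lhs => rw [← hinv]
        rfl
      exact and_congr hEw hw
    rw [hC1, hC2, walkLaw_preimage_shift p x (hE.inter hC'm), walkLaw_preimage_shift p x hC'm,
      ← ENNReal.tsum_mul_left]
    refine tsum_congr fun e => ?_
    rw [ih hC'm hdep', mul_left_comm]

/-- The shift on the path space of a random walk is ergodic: an invariant event is independent
of all events that depend on finitely many coordinates, hence of itself. -/
theorem ergodic_shift (hgen : AddSubmonoid.closure {e | p e ≠ 0} = ⊤) :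
    Ergodic shift (walkMeasure p) := by
  refine ⟨measurePreserving_shift p, ⟨fun E hE hinv => ?_⟩⟩
  set c := walkLaw p 0 E with hcdef
  have hc : ∀ x, walkLaw p x E = c := fun x => walkLaw_eq_of_invariant p hgen hE hinv x 0
  have hmeas : (walkLaw p 0).restrict E = c • walkLaw p 0 := by
    refine ext_of_generate_finite (measurableCylinders fun _ : ℕ => G)
      generateFrom_measurableCylinders.symm isPiSystem_measurableCylinders (fun C hC => ?_) ?_
    · have hCm : MeasurableSet C := MeasurableSet.of_mem_measurableCylinders hC
      obtain ⟨s, S, -, rfl⟩ := (mem_measurableCylinders _).1 hC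
      rw [Measure.restrict_apply hCm, Set.inter_comm, Measure.smul_apply, smul_eq_mul]
      refine walkLaw_inter_of_dependsOn p hE hinv hc (s.sup id + 1) hCm (fun w w' h => ?_) 0
      have : s.restrict w = s.restrict w' := by
        funext i
        exact h i (Nat.lt_succ_of_le (Finset.le_sup (f := id) i.2))
      simp only [mem_cylinder, this]
    · simp [hcdef]
  have hcc : c = c * c := by
    have := congrArg (fun μ : Measure (ℕ → G) => μ E) hmeas
    simpa [hcdef] using this
  have hctop : c ≠ ∞ := measure_ne_top _ _
  rw [eventuallyConst_set']
  by_cases hc0 : c = 0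
  · left
    rw [ae_eq_empty, walkMeasure, Measure.sum_apply _ hE, ENNReal.tsum_eq_zero]
    exact fun x => (hc x).trans hc0
  · right
    have hc1 : c = 1 := by
      have h := (ENNReal.mul_right_inj (b := 1) (c := c) hc0 hctop).1 (by rw [mul_one]; exact hcc)
      exact h.symm
    rw [ae_eq_univ, walkMeasure, Measure.sum_apply _ hE.compl, ENNReal.tsum_eq_zero]
    intro x
    rw [prob_compl_eq_zero_iff hE, hc, hc1]

end Ergodicity

/-! ### The Green function as a return sequence -/

section Green

variable {G : Type*} [AddCommGroup G] (p : PMF G)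

/-- The truncated Green function `∑_{k < n} p_k(y)`. -/
noncomputable def green (n : ℕ) (y : G) : ℝ≥0∞ := ∑ k ∈ Finset.range n, stepProb p k y

theorem green_ne_top (n : ℕ) (y : G) : green p n y ≠ ∞ :=
  (ENNReal.sum_lt_top.2 fun k _ => (stepProb_le_one p k y).trans_lt ENNReal.one_lt_top).ne

theorem green_mono (y : G) : Monotone fun n => green p n y := fun _ _ h =>
  Finset.sum_le_sum_of_subset (Finset.range_mono h)

theorem green_succ (n : ℕ) (y : G) :
    green p (n + 1) y = ∑' e, p e * green p n (y - e) + stepProb p 0 y := by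
  simp only [green]
  rw [Finset.sum_range_succ']
  simp_rw [Finset.mul_sum]
  rw [Summable.tsum_finsetSum fun _ _ => ENNReal.summable]
  rfl

/-- Maximum principle: the truncated Green function is largest at the starting point. -/
theorem green_le_zero (n : ℕ) (y : G) : green p n y ≤ green p n 0 := by
  induction n generalizing y with
  | zero => simp [green]
  | succ n ih =>
    by_cases hy : y = 0
    · rw [hy]
    calc green p (n + 1) y = ∑' e, p e * green p n (y - e) := by
          rw [green_succ]
          simp [stepProb, hy]
      _ ≤ ∑' e, p e * green p n 0 := by
          gcongr with e
          exact ih _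
      _ = green p n 0 := by rw [ENNReal.tsum_mul_right, p.tsum_coe, one_mul]
      _ ≤ green p (n + 1) 0 := green_mono p 0 n.le_succ

/-- The defect of the truncated Green function at a point is bounded in `n`. The defect
`green p n 0 - green p n y` is nonnegative and harmonic up to an error of at most one, so that a
bound at `y` gives a bound at `y - e` for each possible step `e`. -/
theorem exists_green_zero_le_add (hgen : AddSubmonoid.closure {e | p e ≠ 0} = ⊤) (y : G) :
    ∃ C ≠ ∞, ∀ n, green p n 0 ≤ green p n y + C := by
  classical
  suffices h : ∀ z : G, ∃ C ≠ ∞, ∀ n, green p n 0 ≤ green p n (-z) + C by simpa using h (-y)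
  intro z
  have hz : z ∈ AddSubmonoid.closure {e | p e ≠ 0} := hgen ▸ trivial
  induction hz using AddSubmonoid.closure_induction_right with
  | zero => exact ⟨0, by simp, fun n => by simp⟩
  | add_right z _ a ha ih =>
    obtain ⟨C, hC, hCn⟩ := ih
    have ha' : p a ≠ 0 := ha
    have hatop : p a ≠ ∞ := p.apply_ne_top a
    refine ⟨(C + 1) / p a, ENNReal.div_ne_top (by simp [hC]) ha', fun n => ?_⟩
    set r : ℝ≥0∞ := ∑' e, if e = a then 0 else p e with hr
    have hr1 : p a + r = 1 := by
      rw [← p.tsum_coe, ENNReal.tsum_eq_add_tsum_ite a]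
    have hrtop : r ≠ ∞ := fun h => by simp [h] at hr1
    have hmean : ∑' e, p e * green p n (-z - e) ≤
        p a * green p n (-z - a) + r * green p n 0 := by
      rw [ENNReal.tsum_eq_add_tsum_ite a, hr, ← ENNReal.tsum_mul_right]
      gcongr with e
      split_ifs
      · simp
      · gcongr
        exact green_le_zero p n _
    have h1 : green p n (-z) ≤ ∑' e, p e * green p n (-z - e) + 1 := by
      refine (green_mono p (-z) n.le_succ).trans ((green_succ p n (-z)).trans_le ?_)
      gcongr
      exact stepProb_le_one p 0 _
    have h2 : p a * green p n 0 + r * green p n 0 ≤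
        (p a * green p n (-z - a) + (C + 1)) + r * green p n 0 := by
      calc p a * green p n 0 + r * green p n 0 = green p n 0 := by
            rw [← add_mul, hr1, one_mul]
        _ ≤ green p n (-z) + C := hCn n
        _ ≤ p a * green p n (-z - a) + r * green p n 0 + 1 + C := by
            gcongr
            exact h1.trans (by gcongr)
        _ = _ := by ring
    have h3 := (ENNReal.add_le_add_iff_right
      (ENNReal.mul_ne_top hrtop (green_ne_top p n 0))).1 h2
    rw [neg_add, ← sub_eq_add_neg]
    refine (ENNReal.mul_le_mul_iff_right ha' hatop).1 (h3.trans_eq ?_)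
    rw [mul_add, ENNReal.mul_div_cancel ha' hatop]

theorem tendsto_green_zero (hrec : ∑' k, stepProb p k 0 = ∞) :
    Tendsto (fun n => (green p n 0).toReal) atTop atTop := by
  have h : Tendsto (fun n => green p n 0) atTop (𝓝 ∞) := hrec ▸ ENNReal.tendsto_nat_tsum _
  refine tendsto_atTop.2 fun b => ?_
  filter_upwards [(ENNReal.tendsto_nhds_top_iff_nnreal.1 h) b.toNNReal] with n hn
  rw [← ENNReal.ofReal_le_iff_le_toReal (green_ne_top p n 0)]
  exact hn.le

/-- **Ratio limit theorem** for the truncated Green function of a recurrent random walk. -/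
theorem tendsto_green_div (hgen : AddSubmonoid.closure {e | p e ≠ 0} = ⊤)
    (hrec : ∑' k, stepProb p k 0 = ∞) (y : G) :
    Tendsto (fun n => (green p n y).toReal / (green p n 0).toReal) atTop (𝓝 1) := by
  obtain ⟨C, hC, hCn⟩ := exists_green_zero_le_add p hgen y
  have hlim := tendsto_green_zero p hrec
  have hlow : Tendsto (fun n => 1 - C.toReal / (green p n 0).toReal) atTop (𝓝 1) := by
    simpa using tendsto_const_nhds.sub (hlim.const_div_atTop C.toReal)
  refine tendsto_of_tendsto_of_tendsto_of_le_of_le' hlow tendsto_const_nhds ?_ ?_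
  · filter_upwards [hlim.eventually_gt_atTop 0] with n hn
    have h := ENNReal.toReal_mono (by simp [hC, green_ne_top]) (hCn n)
    rw [ENNReal.toReal_add (green_ne_top p n y) hC] at h
    rw [le_div_iff₀ hn, sub_mul, div_mul_cancel₀ _ hn.ne']
    linarith
  · filter_upwards [hlim.eventually_gt_atTop 0] with n hn
    rw [div_le_one hn]
    exact ENNReal.toReal_mono (green_ne_top p n 0) (green_le_zero p n y)

variable [MeasurableSpace G] [Countable G] [MeasurableSingletonClass G]

theorem setLIntegral_stepProb (k : ℕ) {A : Set (ℕ → G)} (hA : MeasurableSet A) :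
    ∫⁻ w in A, stepProb p k (w 0) ∂(walkMeasure p) = walkLaw p 0 (shift^[k] ⁻¹' A) := by
  rw [setLIntegral_walkMeasure p _ hA, walkLaw_preimage_iterate_shift p k 0 hA]
  simp

omit [AddCommGroup G] in
theorem measurable_comp_eval_zero {α : Type*} [MeasurableSpace α] (g : G → α) :
    Measurable fun w : ℕ → G => g (w 0) :=
  (Measurable.of_discrete (f := g)).comp (measurable_pi_apply 0)

theorem integrable_stepProb (k : ℕ) :
    Integrable (fun w : ℕ → G => (stepProb p k (w 0)).toReal) (walkMeasure p) := by
  refine integrable_toReal_of_lintegral_ne_top (measurable_comp_eval_zero _).aemeasurable ?_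
  have h := setLIntegral_stepProb p k MeasurableSet.univ
  rw [Measure.restrict_univ] at h
  rw [h]
  exact measure_ne_top _ _

theorem setIntegral_stepProb (k : ℕ) {A : Set (ℕ → G)} (hA : MeasurableSet A) :
    ∫ w in A, (stepProb p k (w 0)).toReal ∂(walkMeasure p) =
      (walkLaw p 0 (shift^[k] ⁻¹' A)).toReal := by
  rw [integral_toReal (measurable_comp_eval_zero _).aemeasurable
    (.of_forall fun w => (stepProb_le_one p k _).trans_lt ENNReal.one_lt_top),
    setLIntegral_stepProb p k hA]

/-- The transfer operator acts on the indicator of the paths that start at `0` through the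
transition probabilities of the walk. -/
theorem iterate_transfer_stepProb (k : ℕ) :
    (transfer shift (walkMeasure p))^[k] (fun w => (stepProb p 0 (w 0)).toReal)
      =ᵐ[walkMeasure p] fun w => (stepProb p k (w 0)).toReal := by
  induction k with
  | zero => rfl
  | succ k ih =>
    rw [Function.iterate_succ_apply', transfer_congr ih]
    refine (integrable_transfer _ _ _).ae_eq_of_forall_setIntegral_eq _ _
      (integrable_stepProb p (k + 1)) fun A hA _ => ?_
    rw [setIntegral_transfer (measurePreserving_shift p) (integrable_stepProb p k) hA,
      setIntegral_stepProb p k (measurable_shift hA), setIntegral_stepProb p (k + 1) hA,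
      ← Set.preimage_comp, ← Function.iterate_succ']

/-- The truncated Green function at the starting point is a return sequence of a recurrent
random walk. -/
theorem isReturnSequence_green (hgen : AddSubmonoid.closure {e | p e ≠ 0} = ⊤)
    (hrec : ∑' k, stepProb p k 0 = ∞) :
    IsReturnSequence shift (walkMeasure p) fun n => (green p n 0).toReal := by
  have hint : ∫ w, (stepProb p 0 (w 0)).toReal ∂(walkMeasure p) = 1 := by
    have h := setIntegral_stepProb p 0 MeasurableSet.univ
    rw [Measure.restrict_univ] at h
    rw [h]
    simp
  refine ⟨fun n hn => ENNReal.toReal_pos ?_ (green_ne_top p n 0),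
    fun w => (stepProb p 0 (w 0)).toReal, integrable_stepProb p 0,
    .of_forall fun _ => ENNReal.toReal_nonneg, by rw [hint]; exact one_pos, ?_⟩
  · have h1 : stepProb p 0 (0 : G) ≤ green p n 0 :=
      Finset.single_le_sum (f := fun k => stepProb p k (0 : G)) (fun _ _ => zero_le)
        (Finset.mem_range.2 hn)
    intro h
    rw [h] at h1
    simp [stepProb] at h1
  · rw [hint]
    filter_upwards [ae_all_iff.2 (iterate_transfer_stepProb p)] with w hw
    refine (tendsto_green_div p hgen hrec (w 0)).congr fun n => ?_
    simp_rw [hw]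
    rw [green, ENNReal.toReal_sum fun k _ =>
      ((stepProb_le_one p k (w 0)).trans_lt ENNReal.one_lt_top).ne, one_div, inv_mul_eq_div]

end Green

/-! ### Simple random walk on `ℤ` and `ℤ²` -/

section SimpleWalk

theorem stepProb_succ_of_eq_uniformOfFinset {G : Type*} [AddCommGroup G] {p : PMF G}
    {s : Finset G} {hs : s.Nonempty} (hp : p = PMF.uniformOfFinset s hs) (k : ℕ) (y : G) :
    stepProb p (k + 1) y = (s.card : ℝ≥0∞)⁻¹ * ∑ e ∈ s, stepProb p k (y - e) := by
  rw [stepProb, tsum_eq_sum (s := s), Finset.mul_sum]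
  · exact Finset.sum_congr rfl fun e he => by
      rw [hp, PMF.uniformOfFinset_apply_of_mem hs he]
  · intro e he
    rw [hp, PMF.uniformOfFinset_apply_of_notMem hs he, zero_mul]

theorem stepProb_stepZ_succ (k : ℕ) (y : ℤ) :
    stepProb stepZ (k + 1) y = 2⁻¹ * (stepProb stepZ k (y - 1) + stepProb stepZ k (y + 1)) := by
  rw [stepProb_succ_of_eq_uniformOfFinset (p := stepZ) rfl, Finset.sum_pair (by norm_num)]
  simp

theorem stepProb_stepZ2_succ (k : ℕ) (x y : ℤ) :
    stepProb stepZ2 (k + 1) (x, y) =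
      4⁻¹ * (stepProb stepZ2 k (x - 1, y) + (stepProb stepZ2 k (x + 1, y) +
        (stepProb stepZ2 k (x, y - 1) + stepProb stepZ2 k (x, y + 1)))) := by
  rw [stepProb_succ_of_eq_uniformOfFinset (p := stepZ2) rfl, Finset.sum_insert (by simp),
    Finset.sum_insert (by simp), Finset.sum_pair (by simp)]
  simp

/-- In the coordinates `x + y` and `x - y`, the simple random walk on `ℤ²` is a pair of
independent simple random walks on `ℤ`. -/
theorem stepProb_stepZ2 (k : ℕ) (x y : ℤ) :
    stepProb stepZ2 k (x, y) = stepProb stepZ k (x + y) * stepProb stepZ k (x - y) := by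
  induction k generalizing x y with
  | zero =>
    simp only [stepProb, Prod.mk_eq_zero]
    by_cases h : x = 0 ∧ y = 0
    · simp [h.1, h.2]
    · rw [if_neg h]
      by_cases h1 : x + y = 0
      · rw [if_neg (show ¬ (x - y = 0) by omega), mul_zero]
      · rw [if_neg h1, zero_mul]
  | succ k ih =>
    rw [stepProb_stepZ2_succ, stepProb_stepZ_succ, stepProb_stepZ_succ, ih, ih, ih, ih]
    have h4 : (4 : ℝ≥0∞)⁻¹ = 2⁻¹ * 2⁻¹ := by
      rw [← ENNReal.mul_inv (by simp) (by simp)]; norm_num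
    rw [h4, show x - 1 + y = x + y - 1 by ring, show x + 1 + y = x + y + 1 by ring,
      show x + (y - 1) = x + y - 1 by ring, show x + (y + 1) = x + y + 1 by ring,
      show x - 1 - y = x - y - 1 by ring, show x + 1 - y = x - y + 1 by ring,
      show x - (y - 1) = x - y + 1 by ring, show x - (y + 1) = x - y - 1 by ring]
    ring

theorem stepProb_stepZ_eq_zero_of_lt (k : ℕ) {y : ℤ} (hy : y < -k) : stepProb stepZ k y = 0 := by
  induction k generalizing y with
  | zero => simp only [stepProb]; rw [if_neg (by simp at hy; omega)]
  | succ k ih =>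
    push_cast at hy
    rw [stepProb_stepZ_succ, ih (by omega), ih (by omega)]
    simp

theorem stepProb_stepZ_eq_zero_of_odd (k : ℕ) {y : ℤ} (hy : (y + k) % 2 = 1) :
    stepProb stepZ k y = 0 := by
  induction k generalizing y with
  | zero => simp only [stepProb]; rw [if_neg (by simp at hy; omega)]
  | succ k ih =>
    push_cast at hy
    rw [stepProb_stepZ_succ, ih (by omega), ih (by omega)]
    simp

theorem stepProb_stepZ_choose (k i : ℕ) :
    stepProb stepZ k (2 * i - k) = (k.choose i : ℝ≥0∞) * 2⁻¹ ^ k := by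
  induction k generalizing i with
  | zero =>
    cases i with
    | zero => simp [stepProb]
    | succ i =>
      simp only [stepProb]
      rw [if_neg (by push_cast; omega)]
      simp
  | succ k ih =>
    rw [stepProb_stepZ_succ]
    cases i with
    | zero =>
      have h := ih 0
      rw [stepProb_stepZ_eq_zero_of_lt k (by push_cast; omega)]
      rw [show (2 * ((0 : ℕ) : ℤ) - (k + 1 : ℕ) + 1) = 2 * ((0 : ℕ) : ℤ) - k by push_cast; ring, h]
      simp [pow_succ, mul_comm]
    | succ i =>
      rw [show (2 * ((i + 1 : ℕ) : ℤ) - (k + 1 : ℕ) - 1) = 2 * (i : ℤ) - k by push_cast; ring,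
        show (2 * ((i + 1 : ℕ) : ℤ) - (k + 1 : ℕ) + 1) = 2 * ((i + 1 : ℕ) : ℤ) - k by
          push_cast; ring, ih, ih, Nat.choose_succ_succ]
      push_cast
      ring

/-- The return probability `C(2k, k) / 4ᵏ` of the simple random walk on `ℤ` at time `2k`. -/
noncomputable def returnProb (k : ℕ) : ℝ := k.centralBinom / 4 ^ k

theorem returnProb_nonneg (k : ℕ) : 0 ≤ returnProb k := by unfold returnProb; positivity

theorem returnProb_succ (k : ℕ) :
    returnProb (k + 1) = returnProb k * ((2 * k + 1) / (2 * k + 2)) := by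
  have h := Nat.succ_mul_centralBinom_succ k
  have h' : ((k : ℝ) + 1) * (k + 1).centralBinom = 2 * (2 * k + 1) * k.centralBinom := by
    exact_mod_cast h
  have h2 : ((k + 1).centralBinom : ℝ) = 2 * (2 * k + 1) * k.centralBinom / (k + 1) := by
    rw [eq_div_iff (by positivity)]; linarith
  rw [returnProb, returnProb, h2, pow_succ]
  field_simp
  ring

/-- Together with `le_returnProb_sq_mul` this determines `returnProb k` up to a constant factor;
the two bounds are chosen so that they are preserved by the recursion `returnProb_succ`. -/
theorem returnProb_sq_mul_le (k : ℕ) : returnProb k ^ 2 * (2 * k + 1) ≤ 1 := by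
  induction k with
  | zero => simp [returnProb]
  | succ k ih =>
    refine le_trans ?_ ih
    rw [returnProb_succ, mul_pow, mul_assoc]
    gcongr
    rw [div_pow, div_mul_eq_mul_div, div_le_iff₀ (by positivity)]
    push_cast
    nlinarith [(Nat.cast_nonneg k : (0 : ℝ) ≤ k)]

theorem le_returnProb_sq_mul (k : ℕ) : 1 ≤ returnProb k ^ 2 * (4 * k + 1) := by
  induction k with
  | zero => simp [returnProb]
  | succ k ih =>
    refine le_trans ih ?_
    rw [returnProb_succ, mul_pow, mul_assoc]
    gcongr
    rw [div_pow, div_mul_eq_mul_div, le_div_iff₀ (by positivity)]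
    push_cast
    nlinarith [(Nat.cast_nonneg k : (0 : ℝ) ≤ k)]

theorem stepProb_stepZ_even (k : ℕ) :
    stepProb stepZ (2 * k) 0 = ENNReal.ofReal (returnProb k) := by
  have h := stepProb_stepZ_choose (2 * k) k
  rw [show (2 * (k : ℤ) - (2 * k : ℕ)) = 0 by push_cast; ring] at h
  rw [h, returnProb, Nat.centralBinom, ENNReal.ofReal_div_of_pos (by positivity),
    ENNReal.ofReal_natCast, ENNReal.ofReal_pow (by norm_num), div_eq_mul_inv, pow_mul,
    ← ENNReal.inv_pow, ← ENNReal.inv_pow]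
  norm_num

theorem stepProb_stepZ2_zero (k : ℕ) :
    stepProb stepZ2 k 0 = stepProb stepZ k 0 * stepProb stepZ k 0 := by
  have h := stepProb_stepZ2 k 0 0
  rw [add_zero, sub_zero] at h
  exact h

theorem tsum_stepProb_stepZ2 : ∑' k, stepProb stepZ2 k 0 = ∞ := by
  rw [eq_top_iff]
  calc ∞ = 4⁻¹ * ∑' j : ℕ, ((j : ℝ≥0∞) + 1)⁻¹ := by
        rw [tsum_ennreal_inv_add_one, ENNReal.mul_top (by simp)]
    _ = ∑' j : ℕ, 4⁻¹ * ((j : ℝ≥0∞) + 1)⁻¹ := ENNReal.tsum_mul_left.symm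
    _ ≤ ∑' j : ℕ, stepProb stepZ2 (2 * j) 0 := by
        refine ENNReal.tsum_le_tsum fun j => ?_
        rw [stepProb_stepZ2_zero, stepProb_stepZ_even, ← ENNReal.ofReal_mul (returnProb_nonneg j)]
        have h1 : (4 : ℝ≥0∞)⁻¹ * ((j : ℝ≥0∞) + 1)⁻¹ = ENNReal.ofReal (4 * ((j : ℝ) + 1))⁻¹ := by
          rw [ENNReal.ofReal_inv_of_pos (by positivity), ENNReal.ofReal_mul (by norm_num),
            ENNReal.ofReal_add (by positivity) zero_le_one,
            ENNReal.mul_inv (by simp) (by simp)]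
          simp
        rw [h1]
        refine ENNReal.ofReal_le_ofReal ?_
        have h2 := le_returnProb_sq_mul j
        rw [inv_eq_one_div, div_le_iff₀ (by positivity)]
        nlinarith [sq_nonneg (returnProb j)]
    _ ≤ ∑' k, stepProb stepZ2 k 0 :=
        ENNReal.tsum_comp_le_tsum_of_injective
          (mul_right_injective₀ (two_ne_zero : (2 : ℕ) ≠ 0)) _

theorem tsum_stepProb_stepZ : ∑' k, stepProb stepZ k 0 = ∞ := by
  rw [eq_top_iff, ← tsum_stepProb_stepZ2]
  refine ENNReal.tsum_le_tsum fun k => ?_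
  rw [stepProb_stepZ2_zero]
  exact mul_le_of_le_one_right' (stepProb_le_one stepZ k 0)

theorem zsmul_mem_of_mem_of_neg_mem {G : Type*} [AddCommGroup G] {S : AddSubmonoid G} {e : G}
    (he : e ∈ S) (he' : -e ∈ S) (n : ℤ) : n • e ∈ S := by
  obtain ⟨k, rfl | rfl⟩ := n.eq_nat_or_neg
  · rw [natCast_zsmul]; exact S.nsmul_mem he k
  · rw [neg_zsmul, natCast_zsmul, ← smul_neg]; exact S.nsmul_mem he' k

theorem closure_support_stepZ : AddSubmonoid.closure {e | stepZ e ≠ 0} = ⊤ := by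
  have hmem : ∀ e ∈ ({1, -1} : Finset ℤ), e ∈ AddSubmonoid.closure {e | stepZ e ≠ 0} :=
    fun e he => AddSubmonoid.subset_closure ((PMF.mem_support_uniformOfFinset_iff _ _).2 he)
  refine eq_top_iff.2 fun n _ => ?_
  simpa using zsmul_mem_of_mem_of_neg_mem (hmem 1 (by simp)) (hmem (-1) (by simp)) n

theorem closure_support_stepZ2 : AddSubmonoid.closure {e | stepZ2 e ≠ 0} = ⊤ := by
  have hmem : ∀ e ∈ ({(1, 0), (-1, 0), (0, 1), (0, -1)} : Finset (ℤ × ℤ)),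
      e ∈ AddSubmonoid.closure {e | stepZ2 e ≠ 0} :=
    fun e he => AddSubmonoid.subset_closure ((PMF.mem_support_uniformOfFinset_iff _ _).2 he)
  refine eq_top_iff.2 fun n _ => ?_
  have h1 := zsmul_mem_of_mem_of_neg_mem (hmem (1, 0) (by simp))
    (by simpa using hmem (-1, 0) (by simp)) n.1
  have h2 := zsmul_mem_of_mem_of_neg_mem (hmem (0, 1) (by simp))
    (by simpa using hmem (0, -1) (by simp)) n.2
  simpa using add_mem h1 h2

/-- On `ℤ` the return sequence grows at least like `√n`. -/
theorem le_green_stepZ (n : ℕ) :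
    √((n : ℝ) + 1) / 4 ≤ (green stepZ (n + 1) 0).toReal := by
  have h1 : ENNReal.ofReal (∑ j ∈ Finset.range (n / 2 + 1), returnProb j) ≤
      green stepZ (n + 1) 0 := by
    rw [ENNReal.ofReal_sum_of_nonneg fun j _ => returnProb_nonneg j, green]
    simp_rw [← stepProb_stepZ_even]
    rw [← Finset.sum_image (g := fun j => 2 * j) (f := fun k => stepProb stepZ k 0)
      (fun a _ b _ h => by simpa using h)]
    refine Finset.sum_le_sum_of_subset fun k hk => ?_
    obtain ⟨j, hj, rfl⟩ := Finset.mem_image.1 hk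
    rw [Finset.mem_range] at hj ⊢
    omega
  rw [← ENNReal.ofReal_le_iff_le_toReal (green_ne_top _ _ _)]
  refine le_trans (ENNReal.ofReal_le_ofReal ?_) h1
  have hs : 0 < √((n : ℝ) + 1) := Real.sqrt_pos.2 (by positivity)
  -- there are at least `(n + 1) / 2` even times up to `n`, each contributing `1 / (2 √(n + 1))`
  have hterm : ∀ j ∈ Finset.range (n / 2 + 1), 1 / (2 * √((n : ℝ) + 1)) ≤ returnProb j := by
    intro j hj
    have hj' : (2 * j : ℝ) ≤ n := by
      have : 2 * j ≤ n := by have := Finset.mem_range.1 hj; omega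
      exact_mod_cast this
    refine le_of_sq_le_sq ?_ (returnProb_nonneg j)
    rw [div_pow, mul_pow, Real.sq_sqrt (by positivity), div_le_iff₀ (by positivity)]
    nlinarith [le_returnProb_sq_mul j, sq_nonneg (returnProb j)]
  have hcard : ((n : ℝ) + 1) / 2 ≤ ((n / 2 + 1 : ℕ) : ℝ) := by
    rw [div_le_iff₀ two_pos]
    have : n + 1 ≤ (n / 2 + 1) * 2 := by omega
    exact_mod_cast this
  calc √((n : ℝ) + 1) / 4 = ((n : ℝ) + 1) / 2 * (1 / (2 * √((n : ℝ) + 1))) := by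
        rw [mul_one_div, div_div, eq_div_iff (by positivity)]
        nlinarith [Real.mul_self_sqrt (show (0 : ℝ) ≤ (n : ℝ) + 1 by positivity)]
    _ ≤ ((n / 2 + 1 : ℕ) : ℝ) * (1 / (2 * √((n : ℝ) + 1))) := by gcongr
    _ = ∑ j ∈ Finset.range (n / 2 + 1), 1 / (2 * √((n : ℝ) + 1)) := by simp
    _ ≤ _ := Finset.sum_le_sum hterm

/-- On `ℤ²` the return sequence grows at most like `log n`. -/
theorem green_stepZ2_le (n : ℕ) : (green stepZ2 n 0).toReal ≤ 1 + Real.log n := by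
  refine le_trans (ENNReal.toReal_le_of_le_ofReal ?_ ?_) (harmonic_le_one_add_log n)
  · exact_mod_cast (Finset.sum_nonneg fun i _ => by positivity : (0 : ℚ) ≤ harmonic n)
  · rw [← sum_range_inv_add_one, green]
    refine Finset.sum_le_sum fun k _ => ?_
    rw [stepProb_stepZ2_zero]
    rcases Nat.even_or_odd' k with ⟨j, rfl | rfl⟩
    · rw [stepProb_stepZ_even, ← ENNReal.ofReal_mul (returnProb_nonneg j), ← pow_two]
      have h : ((2 * j : ℕ) + 1 : ℝ≥0∞)⁻¹ = ENNReal.ofReal (2 * (j : ℝ) + 1)⁻¹ := by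
        rw [ENNReal.ofReal_inv_of_pos (by positivity), ENNReal.ofReal_add (by positivity) (by simp),
          ENNReal.ofReal_mul (by norm_num)]
        simp
      rw [h]
      refine ENNReal.ofReal_le_ofReal ?_
      rw [inv_eq_one_div, le_div_iff₀ (by positivity)]
      exact returnProb_sq_mul_le j
    · rw [stepProb_stepZ_eq_zero_of_odd _ (by push_cast; omega)]
      simp

theorem summable_green_stepZ :
    Summable fun n : ℕ => 1 / (((n + 1 : ℕ) : ℝ) * (green stepZ (n + 1) 0).toReal) := by
  have h : Summable fun n : ℕ => 4 * (1 / ((n + 1 : ℕ) : ℝ) ^ (3 / 2 : ℝ)) :=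
    ((summable_nat_add_iff 1).2
      (Real.summable_one_div_nat_rpow.2 (by norm_num : (1 : ℝ) < 3 / 2))).mul_left 4
  refine Summable.of_nonneg_of_le (fun n => by positivity) (fun n => ?_) h
  have hpos : (0 : ℝ) < (n : ℝ) + 1 := by positivity
  have hs : 0 < √((n : ℝ) + 1) := Real.sqrt_pos.2 hpos
  have hrpow : ((n + 1 : ℕ) : ℝ) ^ (3 / 2 : ℝ) = ((n : ℝ) + 1) * √((n : ℝ) + 1) := by
    push_cast
    rw [show (3 / 2 : ℝ) = 1 + 1 / 2 by norm_num, Real.rpow_add hpos, Real.rpow_one,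
      Real.sqrt_eq_rpow]
  rw [hrpow]
  calc 1 / (((n + 1 : ℕ) : ℝ) * (green stepZ (n + 1) 0).toReal)
      ≤ 1 / (((n + 1 : ℕ) : ℝ) * (√((n : ℝ) + 1) / 4)) := by
        gcongr
        exact le_green_stepZ n
    _ = 4 * (1 / (((n : ℝ) + 1) * √((n : ℝ) + 1))) := by
        push_cast
        field_simp

theorem not_summable_one_div_mul_one_add_log :
    ¬ Summable fun n : ℕ => 1 / ((n : ℝ) * (1 + Real.log n)) := by
  -- Cauchy condensation turns the series into one that dominates the harmonic series
  rw [← summable_condensed_iff_of_nonneg]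
  · intro h
    refine Real.not_summable_one_div_natCast ((summable_nat_add_iff 1).1 ?_)
    refine Summable.of_nonneg_of_le (fun n => by positivity) (fun k => ?_) h
    have hlog : Real.log ((2 ^ k : ℕ) : ℝ) ≤ k := by
      push_cast
      rw [Real.log_pow]
      have : Real.log 2 ≤ 1 := by linarith [Real.log_two_lt_d9]
      exact mul_le_of_le_one_right (by positivity) this
    have hlog0 : 0 ≤ Real.log ((2 ^ k : ℕ) : ℝ) := Real.log_natCast_nonneg _
    calc 1 / ((k + 1 : ℕ) : ℝ) ≤ 1 / (1 + Real.log ((2 ^ k : ℕ) : ℝ)) := by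
          refine one_div_le_one_div_of_le (by positivity) ?_
          push_cast at hlog ⊢
          linarith
      _ = 2 ^ k * (1 / (((2 ^ k : ℕ) : ℝ) * (1 + Real.log ((2 ^ k : ℕ) : ℝ)))) := by
          push_cast
          field_simp
  · intro n
    have := Real.log_natCast_nonneg n
    positivity
  · intro i j hi hij
    have h1 : (0 : ℝ) < i := by exact_mod_cast hi
    have h2 := Real.log_natCast_nonneg i
    have h3 : (i : ℝ) ≤ j := by exact_mod_cast hij
    gcongr

theorem not_summable_green_stepZ2 :
    ¬ Summable fun n : ℕ => 1 / (((n + 1 : ℕ) : ℝ) * (green stepZ2 (n + 1) 0).toReal) := by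
  intro h
  refine not_summable_one_div_mul_one_add_log ((summable_nat_add_iff 1).1 ?_)
  refine Summable.of_nonneg_of_le (fun n => ?_) (fun n => ?_) h
  · have := Real.log_natCast_nonneg (n + 1)
    positivity
  · have hpos := (isReturnSequence_green stepZ2 closure_support_stepZ2 tsum_stepProb_stepZ2).1
      (n + 1) (by omega)
    have := green_stepZ2_le (n + 1)
    gcongr

end SimpleWalk

end LogLowerBounded

theorem proposition3p1 :
    (∀ (X : Type*) [MeasurableSpace X] (m : MeasureTheory.Measure X) [MeasureTheory.SigmaFinite m]
        (T : X → X), MeasureTheory.Conservative T m → Ergodic T m →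
        ∀ a : ℕ → ℝ, LogLowerBounded.IsReturnSequence T m a →
          (LogLowerBounded.IsLLB T m ↔
            Summable fun n : ℕ => 1 / (((n + 1 : ℕ) : ℝ) * a (n + 1)))) ∧
    (MeasureTheory.Conservative LogLowerBounded.shift
        (LogLowerBounded.walkMeasure LogLowerBounded.stepZ) ∧
      Ergodic LogLowerBounded.shift (LogLowerBounded.walkMeasure LogLowerBounded.stepZ) ∧
      LogLowerBounded.IsPointwiseDualErgodic LogLowerBounded.shift
        (LogLowerBounded.walkMeasure LogLowerBounded.stepZ) ∧
      LogLowerBounded.IsLLB LogLowerBounded.shift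
        (LogLowerBounded.walkMeasure LogLowerBounded.stepZ)) ∧
    (MeasureTheory.Conservative LogLowerBounded.shift
        (LogLowerBounded.walkMeasure LogLowerBounded.stepZ2) ∧
      Ergodic LogLowerBounded.shift (LogLowerBounded.walkMeasure LogLowerBounded.stepZ2) ∧
      LogLowerBounded.IsPointwiseDualErgodic LogLowerBounded.shift
        (LogLowerBounded.walkMeasure LogLowerBounded.stepZ2) ∧
      ¬ LogLowerBounded.IsLLB LogLowerBounded.shift
        (LogLowerBounded.walkMeasure LogLowerBounded.stepZ2)) := by
  open LogLowerBounded in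
  have hc1 := conservative_shift stepZ tsum_stepProb_stepZ
  have he1 := ergodic_shift stepZ closure_support_stepZ
  have hr1 := isReturnSequence_green stepZ closure_support_stepZ tsum_stepProb_stepZ
  have hc2 := conservative_shift stepZ2 tsum_stepProb_stepZ2
  have he2 := ergodic_shift stepZ2 closure_support_stepZ2
  have hr2 := isReturnSequence_green stepZ2 closure_support_stepZ2 tsum_stepProb_stepZ2
  exact ⟨fun X _ m _ T hc he a ha => isLLB_iff_summable hc he ha,
    ⟨hc1, he1, ⟨_, hr1⟩, (isLLB_iff_summable hc1 he1 hr1).2 summable_green_stepZ⟩,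
    ⟨hc2, he2, ⟨_, hr2⟩,
      fun h => not_summable_green_stepZ2 ((isLLB_iff_summable hc2 he2 hr2).1 h)⟩⟩
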